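/- **Setting.** Let $p\ge 1$ be an integer, $\mathcal Z\subseteq\mathbb R^d$ closed and convex, $\mu,L_p,\epsilon>0$, and let $h$ be a real function that is $p$ times continuously differentiable around every point of $\mathcal Z$, such that $$\|\nabla^p h(z)-\nabla^p h(z')\|\le L_p\|z-z'\|,\qquad h(z)\ge h(z')+\langle\nabla h(z'),z-z'\rangle+\frac{\mu}{p+1}\|z-z'\|^{p+1}\qquad(z,z'\in\mathcal Z).$$ Let $z^*$ be the minimizer of $h$ over $\mathcal Z$, $z^{(0)}\in\mathcal Z$ and $\Delta=h(z^{(0)})-h(z^*)$. A call of the $p$th-order oracle at $x$ returns $h(x),\nabla h(x),\dots,\nabla^p h(x)$. **Tensor step.** A $p$th-order tensor step from $\bar z\in\mathcal Z$ is any point $\tilde z\in\mathcal Z$ with $\langle m_{\bar z}(\tilde z),z'-\tilde z\rangle\ge 0$ for all $z'\in\mathcal Z$, where $$m_{\bar z}(z)=\sum_{k=0}^{p-1}\frac1{k!}\nabla^k(\nabla h)(\bar z)[z-\bar z]^k+\frac{2L_p}{p!}\|z-\bar z\|^{p-1}(z-\bar z);$$ with it comes the vector $u=-m_{\bar z}(\tilde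 z)$ of the normal cone of $\mathcal Z$ at $\tilde z$. **Algorithm (OptMS-restart), parameter $\gamma=L_p$.** There are $S$ epochs of $T$ iterations. Epoch $s$ starts with $v_0=z_0=\tilde z_0=z^{(s)}$, $A_0=0$, $\lambda_1'=1$. Iteration $t=0,\dots,T-1$ of the epoch is as follows. 1. Let $a'_{t+1}>0$ solve $A_t+a'_{t+1}=2\lambda'_{t+1}(a'_{t+1})^2$, put $A'_{t+1}=A_t+a'_{t+1}$ and $\bar z_t=\frac{A_t}{A'_{t+1}}z_t+\frac{a'_{t+1}}{A'_{t+1}}v_t$. 2. Let $(\tilde z_{t+1},u_{t+1})$ be given by a tensor step from $\bar z_t$, and $\lambda_{t+1}=\gamma\|\tilde z_{t+1}-\bar z_t\|^{p-1}$ (with $0^0=1$). 3. If $t=0$, replace $\lambda_1'$ by $\lambda_1$ and solve for $a_1'$ and $A_1'$ again with this value (which leaves $\bar z_0=z^{(s)}$ unchanged). If $\lambda'_1=0$, then $\tilde z_1=\bar z_0$ is the minimizer, and the epoch stops with $z_1=\tilde z_1$. 4. If $\lambda_{t+1}\le\lambda'_{t+1}$, put $\gamma_{t+1}=1$ and $\lambda'_{t+2}=\frac12\lambda'_{t+1}$;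 otherwise put $\gamma_{t+1}=\lambda'_{t+1}/\lambda_{t+1}$ and $\lambda'_{t+2}=2\lambda'_{t+1}$. In both cases $a_{t+1}=\gamma_{t+1}a'_{t+1}$, $A_{t+1}=A_t+a_{t+1}$. 5. Put $z_{t+1}=\frac{(1-\gamma_{t+1})A_t}{A_{t+1}}z_t+\frac{\gamma_{t+1}A'_{t+1}}{A_{t+1}}\tilde z_{t+1}$ and $v_{t+1}=\mathrm{Proj}_{\mathcal Z}\big(v_t-a_{t+1}(\nabla h(\tilde z_{t+1})+u_{t+1})\big)$. The epoch returns as $z^{(s+1)}$ the point with the lowest value of $h$ among the points $z_t,\tilde z_t$, $0\le t\le T$, that were computed. The oracle is called for the values $h(z_t),h(\tilde z_t)$, for each tensor step, and for each gradient $\nabla h(\tilde z_{t+1})$. **Theorem (OptMS-restart).** There are constants $c,C>0$ that depend only on $p$ such that, for all data as above, with $$T=\Big\lceil c\,(L_p/\mu)^{2/(3p+1)}\Big\rceil,\qquad S=\max\{0,\lceil\log_2(\Delta/\epsilon)\rceil\}\quad(S=0\text{ if }\Delta=0),$$ the algorithm can be run (all its steps are solvable), and every run of it returns a point $z^{(S)}\in\mathcal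 Z$ with $h(z^{(S)})-h(z^*)\le\epsilon$ after at most $$C\,\max\{1,(L_p/\mu)^{2/(3p+1)}\}\,\max\{1,\log(\Delta/\epsilon)\}$$ calls of the $p$th-order oracle (where the last factor is $1$ if $\Delta=0$); that is, $\mathcal O\big((L_p/\mu)^{2/(3p+1)}\log(\Delta/\epsilon)\big)$ calls if $L_p\ge\mu$ and $\Delta\ge 2\epsilon$. -/

import Mathlib

open scoped Nat Gradient RealInnerProductSpace

noncomputable section

variable {E : Type*} [NormedAddCommGroup E] [InnerProductSpace ℝ E] [CompleteSpace E]

/-- `h` is `q`-th-order `μ`-uniformly convex on `Z`. -/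
def UniformlyConvex (q : ℕ) (μ : ℝ) (Z : Set E) (h : E → ℝ) : Prop :=
  ∀ z ∈ Z, ∀ z' ∈ Z, h z' + ⟪∇ h z', z - z'⟫ + μ / q * ‖z - z'‖ ^ q ≤ h z

/-- `h` is `p` times continuously differentiable around every point of `Z`, and its `p`-th
derivative is `L`-Lipschitz on `Z` (for the operator norm of `p`-linear forms). -/
def LipschitzDerivOn (p : ℕ) (L : ℝ) (Z : Set E) (h : E → ℝ) : Prop :=
  (∀ z ∈ Z, ContDiffAt ℝ p h z) ∧
  ∀ z ∈ Z, ∀ z' ∈ Z, ‖iteratedFDeriv ℝ p h z - iteratedFDeriv ℝ p h z'‖ ≤ L * ‖z - z'‖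

/-- The Taylor polynomial of degree `p - 1` of the operator `F` at `zbar`, evaluated at `z`:
`∑_{k < p} (1 / k!) ∇^k F(zbar)[z - zbar]^k`. -/
def taylorField (p : ℕ) (F : E → E) (zbar z : E) : E :=
  ∑ k ∈ Finset.range p, ((k ! : ℝ)⁻¹) • iteratedFDeriv ℝ k F zbar (fun _ => z - zbar)

/-- The regularized model `F̄_{p-1}(z; zbar) + (M / p!) ‖z - zbar‖^(p-1) (z - zbar)`. -/
def regularizedModel (p : ℕ) (F : E → E) (M : ℝ) (zbar z : E) : E :=
  taylorField p F zbar z + (M / (p ! : ℝ) * ‖z - zbar‖ ^ (p - 1)) • (z - zbar)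

/-- `z` is an output of the `p`-th-order tensor step from `zbar` for the operator `F` with
regularization `M` over `Z`: it solves the variational inequality of the regularized model. -/
def IsTensorStep (p : ℕ) (F : E → E) (M : ℝ) (Z : Set E) (zbar z : E) : Prop :=
  z ∈ Z ∧ ∀ z' ∈ Z, 0 ≤ ⟪regularizedModel p F M zbar z, z' - z⟫

/-- `w` is the Euclidean projection of `x` to `Z`. -/
def IsProj (Z : Set E) (x w : E) : Prop :=
  w ∈ Z ∧ ∀ y ∈ Z, ‖x - w‖ ≤ ‖x - y‖

/-- The proximal oracle implemented by a tensor step with regularization `M`: it returns the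
tensor step `zt` from `zbar` together with the vector `u` that the variational inequality puts
into the normal cone of `Z` at `zt`. -/
def IsTensorProx (p : ℕ) (M : ℝ) (Z : Set E) (h : E → ℝ) (zbar zt u : E) : Prop :=
  IsTensorStep p (∇ h) M Z zbar zt ∧ u = -regularizedModel p (∇ h) M zbar zt

/-- The variables of an epoch at the beginning of iteration `t`: the points `z_t`, `v_t`, `z̃_t`,
the numbers `A_t` and `λ'_{t+1}`, and the list of the points at which the `p`-th-order oracle
`x ↦ (h x, ∇h x, …, ∇^p h x)` has been called so far (a point called twice is listed twice). -/
structure IterState (E : Type*) where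
  z : E
  v : E
  zt : E
  A : ℝ
  lam' : ℝ
  queries : List E

/-- The state at the start of an epoch from `z`. There is no `z̃_0`; it is set to `z`. -/
def IterState.init (z : E) : IterState E :=
  { z := z, v := z, zt := z, A := 0, lam' := 1, queries := [] }

/-- Iteration `t` of an epoch, with exact oracles, `iProx` implemented by the tensor step with
regularization `M`, and parameter `γ`.

In iteration `0` the guess `λ'_1` is replaced by `λ_1`, and `a'_1` is solved for again with this
value; in the other iterations `lam'` is unchanged and `a'` is the number `a₀` found before.
If `λ'_1` becomes `0`, the equation for `a'_1` has no positive solution. Then `z̃_1 = z̄_0`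
is a minimizer of `h` over `Z`, and the epoch halts: `lam' = 0` marks a halted state. -/
def IsIteration (p : ℕ) (M γ : ℝ) (Z : Set E) (h : E → ℝ) (t : ℕ) (s s' : IterState E) : Prop :=
  if s.lam' = 0 then s' = s else
  ∃ (a₀ : ℝ) (zbar zt u : E),
    0 < a₀ ∧ s.A + a₀ = 2 * s.lam' * a₀ ^ 2 ∧
    zbar = (s.A / (s.A + a₀)) • s.z + (a₀ / (s.A + a₀)) • s.v ∧
    IsTensorProx p M Z h zbar zt u ∧
    let lam : ℝ := γ * ‖zt - zbar‖ ^ (p - 1)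
    let lam' : ℝ := if t = 0 then lam else s.lam'
    if lam' = 0 then
      s' = { z := zt, v := s.v, zt := zt, A := s.A, lam' := 0,
             queries := s.queries ++ [s.z, s.zt, zbar] }
    else
      ∃ (a' : ℝ) (v' : E),
        0 < a' ∧ s.A + a' = 2 * lam' * a' ^ 2 ∧
        let gam : ℝ := if lam ≤ lam' then 1 else lam' / lam
        let a : ℝ := gam * a'
        let A' : ℝ := s.A + a'
        let A : ℝ := s.A + a
        IsProj Z (s.v - a • (∇ h zt + u)) v' ∧
        s' = { z := ((1 - gam) * s.A / A) • s.z + (gam * A' / A) • zt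
               v := v'
               zt := zt
               A := A
               lam' := if lam ≤ lam' then lam' / 2 else 2 * lam'
               queries := s.queries ++ [s.z, s.zt, zbar, zt] }

/-- An epoch of `T` iterations started at `z`, which returns `zout`, a point with the lowest
value of `h` among `z_t`, `z̃_t`, `0 ≤ t ≤ T`, and calls the oracle at the points `queries`
(the last two calls give the values of `h` at `z_T` and `z̃_T`). -/
def IsEpoch (p : ℕ) (M γ : ℝ) (Z : Set E) (h : E → ℝ) (T : ℕ) (z zout : E)
    (queries : List E) : Prop :=
  ∃ st : ℕ → IterState E,
    st 0 = IterState.init z ∧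
    (∀ t < T, IsIteration p M γ Z h t (st t) (st (t + 1))) ∧
    (∃ i ≤ T, ∃ j ≤ T,
      (∀ t ≤ T, h (st i).z ≤ h (st t).z) ∧
      (∀ t ≤ T, h (st j).zt ≤ h (st t).zt) ∧
      zout = if h (st i).z < h (st j).zt then (st i).z else (st j).zt) ∧
    queries = (st T).queries ++ [(st T).z, (st T).zt]

/-- A run of the restarted method: `S` epochs of `T` iterations each, the first one from `z0`,
each later one from the point returned by the epoch before. `zout` is the point returned at the
end, `N` the total number of oracle calls. -/
def IsRestartRun (p : ℕ) (M γ : ℝ) (Z : Set E) (h : E → ℝ) (T S : ℕ) (z0 zout : E)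
    (N : ℕ) : Prop :=
  ∃ (zs : ℕ → E) (qs : ℕ → List E),
    zs 0 = z0 ∧
    (∀ s < S, IsEpoch p M γ Z h T (zs s) (zs (s + 1)) (qs s)) ∧
    zout = zs S ∧
    N = ∑ s ∈ Finset.range S, (qs s).length

end

/-!
The energy `A_t (h z_t - h z*) + ‖v_t - z*‖² / 2` never increases along an epoch, because a tensor
step approximately solves the proximal subproblem with parameter `λ_{t+1}`; at a step with
`λ_{t+1} > λ'_{t+1}` it even drops by a multiple of `A_t λ'_{t+1} ‖z̃_{t+1} - z̄_t‖²`. So a step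
that halves `λ'` enlarges `√A` by about `1 / √λ'`, while a step that doubles `λ'` has a long tensor
step, as `λ'_{t+1} < λ_{t+1} = L ‖z̃_{t+1} - z̄_t‖ ^ (p - 1)`, and consumes energy. Weighing the two
kinds of steps against each other with the first step, where `A_1 λ_1 = 1 / 2`, as reference gives
`T ≤ C (L R ^ (p - 1) A_T) ^ (2 / (3 p + 1))` with `R = ‖z_0 - z*‖`.
With `T` of order `(L / μ) ^ (2 / (3 p + 1))` this makes `A_T` at least of order
`1 / (μ R ^ (p - 1))`, so that the gap `h z_T - h z* ≤ R² / (2 A_T)` is at most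
`μ R ^ (p + 1) / (2 (p + 1))`, which by uniform convexity is at most half the initial gap.
-/

section Taylor

variable {E F : Type*} [NormedAddCommGroup E] [NormedSpace ℝ E]
  [NormedAddCommGroup F] [NormedSpace ℝ F]

theorem hasDerivAt_sum_inv_factorial_smul_pow (a : ℕ → F) (n : ℕ) (s : ℝ) :
    HasDerivAt (fun s : ℝ => ∑ i ∈ Finset.range (n + 1), ((i ! : ℝ)⁻¹ * s ^ i) • a i)
      (∑ i ∈ Finset.range n, ((i ! : ℝ)⁻¹ * s ^ i) • a (i + 1)) s := by
  simp only [Finset.sum_range_succ' _ n, pow_zero]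
  refine (HasDerivAt.fun_sum fun i _ => HasDerivAt.smul_const ?_ _).add_const _
  refine ((hasDerivAt_pow (i + 1) s).const_mul _).congr_deriv ?_
  have hi : (i ! : ℝ) ≠ 0 := by positivity
  rw [Nat.factorial_succ, Nat.add_sub_cancel]
  push_cast
  field_simp

theorem hasDerivAt_mul_pow_succ_div_factorial (K : ℝ) (n : ℕ) (s : ℝ) :
    HasDerivAt (fun s => K * s ^ (n + 1) / ((n + 1)! : ℝ)) (K * s ^ n / (n ! : ℝ)) s := by
  refine (((hasDerivAt_pow (n + 1) s).const_mul K).div_const _).congr_deriv ?_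
  have hn : (n ! : ℝ) ≠ 0 := by positivity
  rw [Nat.factorial_succ, Nat.add_sub_cancel]
  push_cast
  field_simp

/- Induction on `m`: the derivative of the remainder of order `m + 1` of `g 0` is the remainder of
order `m` of `g 1`. -/
theorem norm_sub_sum_smul_le_of_hasDerivAt {K : ℝ} (m : ℕ) (g : ℕ → ℝ → F)
    (hg : ∀ i < m, ∀ s ∈ Set.Icc (0 : ℝ) 1, HasDerivAt (g i) (g (i + 1) s) s)
    (hK : ∀ s ∈ Set.Icc (0 : ℝ) 1, ‖g m s - g m 0‖ ≤ K * s) :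
    ∀ s ∈ Set.Icc (0 : ℝ) 1,
      ‖g 0 s - ∑ i ∈ Finset.range (m + 1), ((i ! : ℝ)⁻¹ * s ^ i) • g i 0‖ ≤
        K * s ^ (m + 1) / ((m + 1)! : ℝ) := by
  induction m generalizing g with
  | zero => simpa using hK
  | succ m ih =>
    have hderiv : ∀ s ∈ Set.Icc (0 : ℝ) 1,
        HasDerivAt (fun s => g 0 s - ∑ i ∈ Finset.range (m + 2), ((i ! : ℝ)⁻¹ * s ^ i) • g i 0)
          (g 1 s - ∑ i ∈ Finset.range (m + 1), ((i ! : ℝ)⁻¹ * s ^ i) • g (i + 1) 0) s :=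
      fun s hs => (hg 0 m.succ_pos s hs).sub
        (hasDerivAt_sum_inv_factorial_smul_pow (fun i => g i 0) (m + 1) s)
    refine image_norm_le_of_norm_deriv_right_le_deriv_boundary
      (fun s hs => (hderiv s hs).continuousAt.continuousWithinAt)
      (fun s hs => (hderiv s ⟨hs.1, hs.2.le⟩).hasDerivWithinAt) ?_
      (hasDerivAt_mul_pow_succ_div_factorial K (m + 1))
      (fun s hs => ih (fun i => g (i + 1)) (fun i hi => hg (i + 1) (by lia)) hK s ⟨hs.1, hs.2.le⟩)
    simp [Finset.sum_range_succ' _ (m + 1)]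

theorem hasDerivAt_iteratedFDeriv_add_smul {f : E → F} {x w : E} {i : ℕ} {s : ℝ}
    (hf : ContDiffAt ℝ (i + 1) f (x + s • w)) :
    HasDerivAt (fun s : ℝ => iteratedFDeriv ℝ i f (x + s • w) (fun _ => w))
      (iteratedFDeriv ℝ (i + 1) f (x + s • w) (fun _ => w)) s := by
  have hd : DifferentiableAt ℝ (iteratedFDeriv ℝ i f) (x + s • w) :=
    hf.differentiableAt_iteratedFDeriv (by exact_mod_cast Nat.lt_succ_self i)
  have hline : HasDerivAt (fun s : ℝ => x + s • w) w s := by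
    simpa using ((hasDerivAt_id s).smul_const w).const_add x
  exact (ContinuousMultilinearMap.apply ℝ (fun _ : Fin i => E) F fun _ => w).hasFDerivAt
    |>.comp_hasDerivAt s (hd.hasFDerivAt.comp_hasDerivAt s hline)

theorem norm_sub_sum_iteratedFDeriv_le {f : E → F} {m : ℕ} {K : ℝ} {Z : Set E}
    (hZ : Convex ℝ Z) (hf : ∀ z ∈ Z, ContDiffAt ℝ m f z)
    (hK : ∀ z ∈ Z, ∀ z' ∈ Z, ‖iteratedFDeriv ℝ m f z - iteratedFDeriv ℝ m f z'‖ ≤ K * ‖z - z'‖)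
    {x y : E} (hx : x ∈ Z) (hy : y ∈ Z) :
    ‖f y - ∑ k ∈ Finset.range (m + 1), (k ! : ℝ)⁻¹ • iteratedFDeriv ℝ k f x fun _ => y - x‖ ≤
      K / ((m + 1)! : ℝ) * ‖y - x‖ ^ (m + 1) := by
  have hmem : ∀ s ∈ Set.Icc (0 : ℝ) 1, x + s • (y - x) ∈ Z := fun s hs =>
    hZ.add_smul_sub_mem hx hy hs
  have hderiv : ∀ i < m, ∀ s ∈ Set.Icc (0 : ℝ) 1,
      HasDerivAt (fun s : ℝ => iteratedFDeriv ℝ i f (x + s • (y - x)) fun _ => y - x)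
        (iteratedFDeriv ℝ (i + 1) f (x + s • (y - x)) fun _ => y - x) s := fun i hi s hs =>
    hasDerivAt_iteratedFDeriv_add_smul ((hf _ (hmem s hs)).of_le (by exact_mod_cast hi))
  have hlip : ∀ s ∈ Set.Icc (0 : ℝ) 1,
      ‖(iteratedFDeriv ℝ m f (x + s • (y - x)) fun _ => y - x) -
        iteratedFDeriv ℝ m f (x + (0 : ℝ) • (y - x)) fun _ => y - x‖ ≤
          K * ‖y - x‖ ^ (m + 1) * s := by
    intro s hs
    have hop := (iteratedFDeriv ℝ m f (x + s • (y - x)) - iteratedFDeriv ℝ m f x).le_opNorm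
      fun _ => y - x
    have hnorm : ‖x + s • (y - x) - x‖ = s * ‖y - x‖ := by
      rw [add_sub_cancel_left, norm_smul, Real.norm_of_nonneg hs.1]
    rw [zero_smul, add_zero]
    rw [Finset.prod_const, Finset.card_univ, Fintype.card_fin] at hop
    calc _ ≤ _ := hop
      _ ≤ K * ‖x + s • (y - x) - x‖ * ‖y - x‖ ^ m := by gcongr; exact hK _ (hmem s hs) _ hx
      _ = _ := by rw [hnorm]; ring
  have key := norm_sub_sum_smul_le_of_hasDerivAt m _ hderiv hlip 1 (by simp)
  simp only [one_smul, iteratedFDeriv_zero_apply, one_pow, mul_one, zero_smul, add_zero,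
    add_sub_cancel] at key
  exact key.trans_eq (mul_div_right_comm _ _ _)

end Taylor

section Symmetry

variable {E F : Type*} [NormedAddCommGroup E] [NormedSpace ℝ E]
  [NormedAddCommGroup F] [NormedSpace ℝ F]

theorem iteratedFDeriv_add_two_apply {f : E → F} {n : ℕ} {x : E}
    (hf : ContDiffAt ℝ (n + 2) f x) (v : Fin (n + 2) → E) :
    iteratedFDeriv ℝ (n + 2) f x v =
      fderiv ℝ (fderiv ℝ (iteratedFDeriv ℝ n f)) x (v 0) (v 1) (Fin.tail (Fin.tail v)) := by
  have hd : DifferentiableAt ℝ (iteratedFDeriv ℝ (n + 1) f) x :=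
    hf.differentiableAt_iteratedFDeriv (by exact_mod_cast Nat.lt_succ_self (n + 1))
  have hd' : DifferentiableAt ℝ (fderiv ℝ (iteratedFDeriv ℝ n f)) x :=
    ((hf.iteratedFDeriv_right (m := 2) (by rw [add_comm])).fderiv_right (m := 1)
      (by rw [one_add_one_eq_two])).differentiableAt one_ne_zero
  have hd'' : DifferentiableAt ℝ (fun y => fderiv ℝ (iteratedFDeriv ℝ n f) y (v 1)) x :=
    hd'.clm_apply (differentiableAt_const _)
  rw [hd.iteratedFDeriv_succ_apply_left']
  refine (congrArg (fun T => T (v 0))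
    (fderiv_continuousMultilinear_apply_const hd'' (Fin.tail (Fin.tail v)))).trans ?_
  rw [fderiv_clm_apply hd' (differentiableAt_const (v 1))]
  simp

theorem iteratedFDeriv_comp_swap {n : ℕ} {f : E → F} {x : E}
    (hf : ContDiffAt ℝ (n + 1) f x) (i : Fin n) (v : Fin (n + 1) → E) :
    iteratedFDeriv ℝ (n + 1) f x (v ∘ Equiv.swap i.castSucc i.succ) =
      iteratedFDeriv ℝ (n + 1) f x v := by
  induction n generalizing x with
  | zero => exact i.elim0
  | succ n ih =>
    induction i using Fin.cases with
    | zero =>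
      have hf' : ContDiffAt ℝ (n + 2) f x := by
        rwa [Nat.cast_succ, add_assoc, one_add_one_eq_two] at hf
      have hsymm : IsSymmSndFDerivAt ℝ (iteratedFDeriv ℝ n f) x :=
        (hf'.iteratedFDeriv_right (m := 2) (by rw [add_comm])).isSymmSndFDerivAt (by simp)
      have htail : Fin.tail (Fin.tail (v ∘ Equiv.swap (0 : Fin (n + 2)) 1)) =
          Fin.tail (Fin.tail v) := by
        funext j
        simp only [Fin.tail, Function.comp_apply]
        rw [← Fin.succ_zero_eq_one, Equiv.swap_apply_of_ne_of_ne (Fin.succ_ne_zero _)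
          fun h => Fin.succ_ne_zero j (Fin.succ_injective _ h)]
      simp only [Fin.castSucc_zero, Fin.succ_zero_eq_one]
      rw [iteratedFDeriv_add_two_apply hf', iteratedFDeriv_add_two_apply hf', htail, hsymm.eq]
      simp
    | succ i =>
      have hd : DifferentiableAt ℝ (iteratedFDeriv ℝ (n + 1) f) x :=
        hf.differentiableAt_iteratedFDeriv (by exact_mod_cast Nat.lt_succ_self (n + 1))
      have htail : Fin.tail (v ∘ Equiv.swap i.succ.castSucc i.succ.succ) =
          Fin.tail v ∘ Equiv.swap i.castSucc i.succ := by
        funext j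
        simp only [Fin.tail, Function.comp_apply]
        rw [Fin.castSucc_succ, ← (Fin.succ_injective _).map_swap]
      have hzero : Equiv.swap i.succ.castSucc i.succ.succ 0 = 0 :=
        Equiv.swap_apply_of_ne_of_ne (Fin.castSucc_succ i ▸ (Fin.succ_ne_zero _).symm)
          (Fin.succ_ne_zero _).symm
      have hev : ∀ᶠ x' in nhds x, ContDiffAt ℝ (n + 1) f x' :=
        (hf.of_le (by exact_mod_cast Nat.le_succ (n + 1))).eventually (by
          exact_mod_cast (ENat.natCast_ne_top (n + 1)))
      rw [hd.iteratedFDeriv_succ_apply_left', hd.iteratedFDeriv_succ_apply_left', htail,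
        Function.comp_apply, hzero]
      congr 1
      refine Filter.EventuallyEq.fderiv_eq ?_
      filter_upwards [hev] with x' hx' using ih hx' i _

theorem iteratedFDeriv_comp_perm_of_contDiffAt {n : ℕ} {f : E → F} {x : E}
    (hf : ContDiffAt ℝ n f x) (σ : Equiv.Perm (Fin n)) (v : Fin n → E) :
    iteratedFDeriv ℝ n f x (v ∘ σ) = iteratedFDeriv ℝ n f x v := by
  cases n with
  | zero => rw [Subsingleton.elim (v ∘ σ) v]
  | succ n =>
    induction σ using Submonoid.induction_of_closure_eq_top_left
        (Equiv.Perm.mclosure_swap_castSucc_succ n) generalizing v with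
    | one => rfl
    | mul_left τ hτ σ ih =>
      obtain ⟨i, rfl⟩ := hτ
      rw [Equiv.Perm.coe_mul, ← Function.comp_assoc, ih, iteratedFDeriv_comp_swap hf]

theorem hasFDerivAt_iteratedFDeriv_sub {n : ℕ} {f : E → F} {x : E}
    (hf : ContDiffAt ℝ (n + 1) f x) (z : E) :
    HasFDerivAt (fun z => iteratedFDeriv ℝ (n + 1) f x (fun _ => z - x))
      ((n + 1 : ℝ) • iteratedFDeriv ℝ n (fderiv ℝ f) x (fun _ => z - x)) z := by
  have hdiag : HasFDerivAt (fun z : E => fun _ : Fin (n + 1) => z - x)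
      (ContinuousLinearMap.pi fun _ => ContinuousLinearMap.id ℝ E) z :=
    hasFDerivAt_pi.2 fun _ => (hasFDerivAt_id z).sub_const x
  refine (((iteratedFDeriv ℝ (n + 1) f x).hasFDerivAt _).comp z hdiag).congr_fderiv ?_
  ext y
  have hupdate : ∀ i : Fin (n + 1),
      iteratedFDeriv ℝ (n + 1) f x (Function.update (fun _ => z - x) i y) =
        iteratedFDeriv ℝ n (fderiv ℝ f) x (fun _ => z - x) y := by
    intro i
    have hswap : Function.update (fun _ => z - x) i y =
        Function.update (fun _ => z - x) (Fin.last n) y ∘ Equiv.swap i (Fin.last n) := by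
      rw [Function.update_comp_equiv]
      simp [Function.comp_def]
    rw [hswap, iteratedFDeriv_comp_perm_of_contDiffAt (by exact_mod_cast hf),
      iteratedFDeriv_succ_apply_right, Fin.init_update_last, Function.update_self]
    rfl
  simp only [ContinuousLinearMap.comp_apply, ContinuousMultilinearMap.linearDeriv_apply,
    ContinuousLinearMap.pi_apply, ContinuousLinearMap.id_apply, hupdate, Finset.sum_const,
    Finset.card_univ, Fintype.card_fin, smul_apply]
  rw [← Nat.cast_smul_eq_nsmul ℝ, Nat.cast_add_one]

theorem hasFDerivAt_sum_iteratedFDeriv_sub {n : ℕ} {f : E → F} {x : E}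
    (hf : ContDiffAt ℝ n f x) (z : E) :
    HasFDerivAt
      (fun z => ∑ k ∈ Finset.range (n + 1), (k ! : ℝ)⁻¹ • iteratedFDeriv ℝ k f x fun _ => z - x)
      (∑ k ∈ Finset.range n, (k ! : ℝ)⁻¹ • iteratedFDeriv ℝ k (fderiv ℝ f) x fun _ => z - x)
      z := by
  simp only [Finset.sum_range_succ' _ n, iteratedFDeriv_zero_apply]
  refine (HasFDerivAt.fun_sum fun k hk => ?_).add_const _
  have hk' : k + 1 ≤ n := Finset.mem_range.1 hk
  refine ((hasFDerivAt_iteratedFDeriv_sub (hf.of_le (by exact_mod_cast hk')) z).const_smul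
    (((k + 1)! : ℝ)⁻¹)).congr_fderiv ?_
  have hfac : (k ! : ℝ) ≠ 0 := by positivity
  rw [smul_smul, Nat.factorial_succ]
  congr 1
  push_cast
  field_simp

theorem norm_sum_iteratedFDeriv_le (n : ℕ) (f : E → F) (x : E) {w : E} (hw : 1 ≤ ‖w‖) :
    ‖∑ k ∈ Finset.range (n + 1), (k ! : ℝ)⁻¹ • iteratedFDeriv ℝ k f x fun _ => w‖ ≤
      (∑ k ∈ Finset.range (n + 1), (k ! : ℝ)⁻¹ * ‖iteratedFDeriv ℝ k f x‖) * ‖w‖ ^ n := by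
  rw [Finset.sum_mul]
  refine norm_sum_le_of_le _ fun k hk => ?_
  have hop := (iteratedFDeriv ℝ k f x).le_opNorm fun _ => w
  rw [Finset.prod_const, Finset.card_univ, Fintype.card_fin] at hop
  rw [norm_smul, Real.norm_of_nonneg (by positivity), mul_assoc]
  gcongr
  refine hop.trans ?_
  gcongr
  exact Nat.lt_succ_iff.1 (Finset.mem_range.1 hk)

end Symmetry

section Gradient

variable {E : Type*} [NormedAddCommGroup E] [InnerProductSpace ℝ E] [CompleteSpace E]

/-- The Fréchet–Riesz isometry `InnerProductSpace.toDual` of a real Hilbert space, inverted and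
bundled as a linear instead of a conjugate-linear map, so that it commutes with iterated
derivatives. -/
noncomputable def rieszIsometry (E : Type*) [NormedAddCommGroup E] [InnerProductSpace ℝ E]
    [CompleteSpace E] : (E →L[ℝ] ℝ) ≃ₗᵢ[ℝ] E where
  toFun := (InnerProductSpace.toDual ℝ E).symm
  invFun := InnerProductSpace.toDual ℝ E
  map_add' := map_add _
  map_smul' c f := by simp
  left_inv := (InnerProductSpace.toDual ℝ E).apply_symm_apply
  right_inv := (InnerProductSpace.toDual ℝ E).symm_apply_apply
  norm_map' := (InnerProductSpace.toDual ℝ E).symm.norm_map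

theorem contDiffAt_gradient {h : E → ℝ} {x : E} {n : ℕ} (hh : ContDiffAt ℝ (n + 1) h x) :
    ContDiffAt ℝ n (∇ h) x :=
  (rieszIsometry E).toContinuousLinearEquiv.contDiff.contDiffAt.comp x hh.fderiv_right_succ

theorem iteratedFDeriv_gradient (h : E → ℝ) (n : ℕ) (x : E) :
    iteratedFDeriv ℝ n (∇ h) x =
      (rieszIsometry E).toLinearIsometry.toContinuousLinearMap.compContinuousMultilinearMap
        (iteratedFDeriv ℝ n (fderiv ℝ h) x) :=
  (rieszIsometry E).toContinuousLinearEquiv.iteratedFDeriv_comp_left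

theorem inner_iteratedFDeriv_gradient (h : E → ℝ) (n : ℕ) (x y : E) (v : Fin n → E) :
    ⟪iteratedFDeriv ℝ n (∇ h) x v, y⟫ = iteratedFDeriv ℝ n (fderiv ℝ h) x v y := by
  rw [iteratedFDeriv_gradient]
  exact InnerProductSpace.toDual_symm_apply

theorem norm_iteratedFDeriv_gradient_sub (h : E → ℝ) (n : ℕ) (x x' : E) :
    ‖iteratedFDeriv ℝ n (∇ h) x - iteratedFDeriv ℝ n (∇ h) x'‖ =
      ‖iteratedFDeriv ℝ (n + 1) h x - iteratedFDeriv ℝ (n + 1) h x'‖ := by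
  have hgrad : iteratedFDeriv ℝ n (∇ h) x - iteratedFDeriv ℝ n (∇ h) x' =
      (rieszIsometry E).toLinearIsometry.toContinuousLinearMap.compContinuousMultilinearMap
        (iteratedFDeriv ℝ n (fderiv ℝ h) x - iteratedFDeriv ℝ n (fderiv ℝ h) x') := by
    ext v
    simp [iteratedFDeriv_gradient]
  rw [hgrad, LinearIsometry.norm_compContinuousMultilinearMap, iteratedFDeriv_succ_eq_comp_right,
    iteratedFDeriv_succ_eq_comp_right, Function.comp_apply, Function.comp_apply]
  exact (LinearIsometryEquiv.norm_map _ _).symm.trans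
    (congrArg norm (LinearIsometryEquiv.map_sub _ _ _))

theorem norm_gradient_sub_taylorField_le {p : ℕ} (hp : 1 ≤ p) {L : ℝ} {Z : Set E} {h : E → ℝ}
    (hZ : Convex ℝ Z) (hL : LipschitzDerivOn p L Z h) {zbar z : E} (hzbar : zbar ∈ Z)
    (hz : z ∈ Z) :
    ‖∇ h z - taylorField p (∇ h) zbar z‖ ≤ L / (p ! : ℝ) * ‖z - zbar‖ ^ p := by
  obtain ⟨n, rfl⟩ := Nat.exists_eq_add_of_le' hp
  refine norm_sub_sum_iteratedFDeriv_le hZ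
    (fun z hz => contDiffAt_gradient (by exact_mod_cast hL.1 z hz)) (fun z hz z' hz' => ?_)
    hzbar hz
  rw [norm_iteratedFDeriv_gradient_sub]
  exact hL.2 z hz z' hz'

end Gradient

section TensorStep

variable {E : Type*} [NormedAddCommGroup E] [InnerProductSpace ℝ E]

/-- The potential of the regularized model: the Taylor polynomial of degree `p` of `h` at `zbar`
plus the power of the distance to `zbar` for which the gradient of the sum is
`regularizedModel p (∇ h) M zbar`. Its minimizers over a convex set are tensor steps. -/
noncomputable def regularizedTaylor (p : ℕ) (h : E → ℝ) (M : ℝ) (zbar z : E) : ℝ :=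
  ∑ k ∈ Finset.range (p + 1), (k ! : ℝ)⁻¹ • iteratedFDeriv ℝ k h zbar (fun _ => z - zbar) +
    M / (p ! : ℝ) / (p + 1) * ‖z - zbar‖ ^ (p + 1)

theorem hasFDerivAt_norm_sub_pow (n : ℕ) (x z : E) :
    HasFDerivAt (fun z : E => ‖z - x‖ ^ (n + 2))
      (((n + 2 : ℝ) * ‖z - x‖ ^ n) • innerSL ℝ (z - x)) z := by
  have hexp : (1 : ℝ) < (n + 2 : ℕ) := by exact_mod_cast Nat.succ_lt_succ n.succ_pos
  have hcomp := (hasFDerivAt_norm_rpow (z - x) hexp).comp z ((hasFDerivAt_id z).sub_const x)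
  simp only [Function.comp_def, id, Real.rpow_natCast] at hcomp
  refine hcomp.congr_fderiv ?_
  rw [Nat.cast_add, Nat.cast_two, add_sub_cancel_right, Real.rpow_natCast]
  rfl

theorem tendsto_regularizedTaylor_cobounded (p : ℕ) (h : E → ℝ) {M : ℝ} (hM : 0 < M) (zbar : E) :
    Filter.Tendsto (regularizedTaylor p h M zbar) (Bornology.cobounded E) Filter.atTop := by
  set C := ∑ k ∈ Finset.range (p + 1), (k ! : ℝ)⁻¹ * ‖iteratedFDeriv ℝ k h zbar‖
  have hm : 0 < M / (p ! : ℝ) / (p + 1) := by positivity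
  have hnorm : Filter.Tendsto (fun z : E => ‖z - zbar‖) (Bornology.cobounded E) Filter.atTop :=
    tendsto_norm_cobounded_atTop.comp (tendsto_sub_const_cobounded zbar)
  have hlin : Filter.Tendsto (fun z : E => M / (p ! : ℝ) / (p + 1) * ‖z - zbar‖ - C)
      (Bornology.cobounded E) Filter.atTop :=
    Filter.tendsto_atTop_add_const_right _ _ (hnorm.const_mul_atTop hm)
  refine Filter.tendsto_atTop_mono' _ ?_ hlin
  filter_upwards [hnorm.eventually_ge_atTop 1, hlin.eventually_ge_atTop 0] with z hz hnonneg
  have hpoly := neg_le_of_abs_le (norm_sum_iteratedFDeriv_le p h zbar hz)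
  calc M / (p ! : ℝ) / (p + 1) * ‖z - zbar‖ - C
      ≤ (M / (p ! : ℝ) / (p + 1) * ‖z - zbar‖ - C) * ‖z - zbar‖ ^ p :=
        le_mul_of_one_le_right hnonneg (one_le_pow₀ hz)
    _ = -(C * ‖z - zbar‖ ^ p) + M / (p ! : ℝ) / (p + 1) * ‖z - zbar‖ ^ (p + 1) := by ring
    _ ≤ regularizedTaylor p h M zbar z := add_le_add_left hpoly _

variable [CompleteSpace E]

theorem hasFDerivAt_regularizedTaylor {p : ℕ} (hp : 1 ≤ p) {h : E → ℝ} {zbar : E}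
    (hh : ContDiffAt ℝ p h zbar) (M : ℝ) (z : E) :
    HasFDerivAt (regularizedTaylor p h M zbar)
      (innerSL ℝ (regularizedModel p (∇ h) M zbar z)) z := by
  obtain ⟨n, rfl⟩ := Nat.exists_eq_add_of_le' hp
  refine ((hasFDerivAt_sum_iteratedFDeriv_sub hh z).add
    ((hasFDerivAt_norm_sub_pow n zbar z).const_mul _)).congr_fderiv ?_
  ext y
  simp only [regularizedModel, taylorField, innerSL_apply_apply, inner_add_left, sum_inner,
    real_inner_smul_left, inner_iteratedFDeriv_gradient, add_apply,
    smul_apply, sum_apply, smul_eq_mul, Nat.add_sub_cancel]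
  push_cast
  field_simp
  ring

theorem isTensorStep_of_isMinOn {p : ℕ} (hp : 1 ≤ p) {Z : Set E} (hZ : Convex ℝ Z) {h : E → ℝ}
    {M : ℝ} {zbar z : E} (hh : ContDiffAt ℝ p h zbar) (hz : z ∈ Z)
    (hmin : IsMinOn (regularizedTaylor p h M zbar) Z z) : IsTensorStep p (∇ h) M Z zbar z :=
  ⟨hz, fun _ hz' => IsLocalMinOn.hasFDerivWithinAt_nonneg hmin.localize
    (hasFDerivAt_regularizedTaylor hp hh M z).hasFDerivWithinAt
    (sub_mem_posTangentConeAt_of_segment_subset (hZ.segment_subset hz hz'))⟩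

theorem exists_isTensorStep [ProperSpace E] {p : ℕ} (hp : 1 ≤ p) {Z : Set E} (hZc : IsClosed Z)
    (hZ : Convex ℝ Z) {h : E → ℝ} {M : ℝ} (hM : 0 < M) {zbar : E} (hzbar : zbar ∈ Z)
    (hh : ContDiffAt ℝ p h zbar) : ∃ z, IsTensorStep p (∇ h) M Z zbar z := by
  have hcont : Continuous (regularizedTaylor p h M zbar) :=
    continuous_iff_continuousAt.2 fun z => (hasFDerivAt_regularizedTaylor hp hh M z).continuousAt
  have hcoercive := tendsto_regularizedTaylor_cobounded p h hM zbar
  rw [Metric.cobounded_eq_cocompact] at hcoercive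
  obtain ⟨z, hz, hmin⟩ := hcont.continuousOn.exists_isMinOn' hZc hzbar
    ((hcoercive.eventually_ge_atTop _).filter_mono inf_le_left)
  exact ⟨z, isTensorStep_of_isMinOn hp hZ hh hz hmin⟩

end TensorStep

section ConvexCombination

variable {E : Type*} [AddCommGroup E] [Module ℝ E]

theorem mem_of_convex_of_smul_eq {Z : Set E} (hZ : Convex ℝ Z) {x y w : E} (hx : x ∈ Z)
    (hy : y ∈ Z) {α β γ : ℝ} (hα : 0 ≤ α) (hβ : 0 ≤ β) (hγ : 0 < γ) (hsum : γ = α + β)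
    (hw : γ • w = α • x + β • y) : w ∈ Z := by
  have hcombo : w = (γ⁻¹ * α) • x + (γ⁻¹ * β) • y := by
    rw [← inv_smul_smul₀ hγ.ne' w, hw, smul_add, smul_smul, smul_smul]
  exact hcombo ▸ hZ hx hy (by positivity) (by positivity)
    (by rw [← mul_add, ← hsum, inv_mul_cancel₀ hγ.ne'])

theorem mul_le_of_convexOn_of_smul_eq {Z : Set E} {h : E → ℝ} (hh : ConvexOn ℝ Z h) {x y w : E}
    (hx : x ∈ Z) (hy : y ∈ Z) {α β γ : ℝ} (hα : 0 ≤ α) (hβ : 0 ≤ β) (hγ : 0 < γ)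
    (hsum : γ = α + β) (hw : γ • w = α • x + β • y) : γ * h w ≤ α * h x + β * h y := by
  have hcombo : w = (γ⁻¹ * α) • x + (γ⁻¹ * β) • y := by
    rw [← inv_smul_smul₀ hγ.ne' w, hw, smul_add, smul_smul, smul_smul]
  have hjensen := hh.2 hx hy (by positivity : 0 ≤ γ⁻¹ * α) (by positivity : 0 ≤ γ⁻¹ * β)
    (by rw [← mul_add, ← hsum, inv_mul_cancel₀ hγ.ne'])
  rw [← hcombo, smul_eq_mul, smul_eq_mul, mul_assoc, mul_assoc, ← mul_add] at hjensen
  rwa [← le_inv_mul_iff₀ hγ]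

end ConvexCombination

section Projection

variable {E : Type*} [NormedAddCommGroup E]

theorem norm_sub_eq_iInf_iff_isProj {Z : Set E} {x w : E} (hw : w ∈ Z) :
    ‖x - w‖ = ⨅ y : Z, ‖x - y‖ ↔ IsProj Z x w := by
  have : Nonempty Z := ⟨⟨w, hw⟩⟩
  have hbdd : BddBelow (Set.range fun y : Z => ‖x - y‖) :=
    ⟨0, by rintro _ ⟨y, rfl⟩; exact norm_nonneg _⟩
  exact ⟨fun hinf => ⟨hw, fun y hy => hinf ▸ ciInf_le hbdd ⟨y, hy⟩⟩,
    fun hproj => le_antisymm (le_ciInf fun y => hproj.2 y y.2) (ciInf_le hbdd ⟨w, hw⟩)⟩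

variable [InnerProductSpace ℝ E]

theorem exists_isProj [CompleteSpace E] {Z : Set E} (hZc : IsClosed Z) (hZ : Convex ℝ Z)
    (hne : Z.Nonempty) (x : E) : ∃ w, IsProj Z x w := by
  obtain ⟨w, hw, hmin⟩ := exists_norm_eq_iInf_of_complete_convex hne hZc.isComplete hZ x
  exact ⟨w, (norm_sub_eq_iInf_iff_isProj hw).1 hmin⟩

theorem IsProj.norm_sub_sq_le {Z : Set E} (hZ : Convex ℝ Z) {x w y : E} (hw : IsProj Z x w)
    (hy : y ∈ Z) : ‖w - y‖ ^ 2 ≤ ‖x - y‖ ^ 2 := by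
  have hobtuse : ⟪x - w, y - w⟫ ≤ 0 :=
    (norm_eq_iInf_iff_real_inner_le_zero hZ hw.1).1 ((norm_sub_eq_iInf_iff_isProj hw.1).2 hw) y hy
  have hexpand : ‖x - y‖ ^ 2 = ‖x - w‖ ^ 2 - 2 * ⟪x - w, y - w⟫ + ‖y - w‖ ^ 2 := by
    rw [← norm_sub_sq_real, sub_sub_sub_cancel_right]
  rw [norm_sub_rev w y, hexpand]
  linarith [sq_nonneg ‖x - w‖]

theorem IsProj.norm_sub_sq_le_of_sub_smul {Z : Set E} (hZ : Convex ℝ Z) {v g v' y : E} {a : ℝ}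
    (hv' : IsProj Z (v - a • g) v') (hy : y ∈ Z) :
    ‖v' - y‖ ^ 2 ≤ ‖v - y‖ ^ 2 - 2 * a * ⟪g, v - y⟫ + a ^ 2 * ‖g‖ ^ 2 := by
  refine (hv'.norm_sub_sq_le hZ hy).trans_eq ?_
  rw [sub_right_comm, norm_sub_sq_real, real_inner_smul_right, norm_smul, mul_pow,
    Real.norm_eq_abs, sq_abs, real_inner_comm]
  ring

theorem inner_add_sq_le_of_norm_add_smul_le {g w : E} {κ gam lam : ℝ} (hκ : 0 ≤ κ)
    (hlam : 0 < lam) (hle : gam * κ ≤ lam) (hg : ‖g + (2 * κ) • w‖ ≤ κ * ‖w‖) :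
    ⟪g, w⟫ + gam / (4 * lam) * ‖g‖ ^ 2 ≤ -(3 / 4 * κ * ‖w‖ ^ 2) := by
  have hsq : ‖g + (2 * κ) • w‖ ^ 2 ≤ (κ * ‖w‖) ^ 2 := pow_le_pow_left₀ (norm_nonneg _) hg 2
  rw [norm_add_sq_real, real_inner_smul_right, norm_smul,
    Real.norm_of_nonneg (by positivity)] at hsq
  rcases hκ.eq_or_lt with rfl | hκ
  · have hg0 : g = 0 := by simpa using hg
    simp [hg0]
  calc ⟪g, w⟫ + gam / (4 * lam) * ‖g‖ ^ 2
      ≤ ⟪g, w⟫ + 1 / (4 * κ) * ‖g‖ ^ 2 := by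
        gcongr _ + ?_ * _
        rw [div_le_div_iff₀ (by positivity) (by positivity)]
        linarith
    _ ≤ ⟪g, w⟫ + 1 / (4 * κ) * (-(4 * κ * ⟪g, w⟫) - 3 * κ ^ 2 * ‖w‖ ^ 2) := by
        gcongr
        linarith
    _ = -(3 / 4 * κ * ‖w‖ ^ 2) := by
        field_simp
        ring

end Projection

section Convexity

variable {E : Type*} [NormedAddCommGroup E] [InnerProductSpace ℝ E] [CompleteSpace E]

theorem UniformlyConvex.add_inner_le {q : ℕ} {μ : ℝ} {Z : Set E} {h : E → ℝ}
    (hh : UniformlyConvex q μ Z h) (hμ : 0 ≤ μ) {z z' : E} (hz : z ∈ Z) (hz' : z' ∈ Z) :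
    h z' + ⟪∇ h z', z - z'⟫ ≤ h z :=
  (le_add_of_nonneg_right (by positivity)).trans (hh z hz z' hz')

theorem UniformlyConvex.convexOn {q : ℕ} {μ : ℝ} {Z : Set E} {h : E → ℝ}
    (hh : UniformlyConvex q μ Z h) (hμ : 0 ≤ μ) (hZ : Convex ℝ Z) : ConvexOn ℝ Z h := by
  refine ⟨hZ, fun x hx y hy α β hα hβ hαβ => ?_⟩
  set z := α • x + β • y with hz
  have hzmem : z ∈ Z := hZ hx hy hα hβ hαβ
  have hcentred : α • (x - z) + β • (y - z) = 0 := by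
    rw [smul_sub, smul_sub, sub_add_sub_comm, ← add_smul, hαβ, one_smul, ← hz, sub_self]
  have hinner : α * ⟪∇ h z, x - z⟫ + β * ⟪∇ h z, y - z⟫ = 0 := by
    rw [← real_inner_smul_right, ← real_inner_smul_right, ← inner_add_right, hcentred,
      inner_zero_right]
  calc h z = α * (h z + ⟪∇ h z, x - z⟫) + β * (h z + ⟪∇ h z, y - z⟫) := by
        linear_combination (-h z) * hαβ - hinner
    _ ≤ α * h x + β * h y := by
        gcongr
        exacts [hh.add_inner_le hμ hx hzmem, hh.add_inner_le hμ hy hzmem]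

theorem IsTensorProx.sub_le_inner {p q : ℕ} {M μ : ℝ} {Z : Set E} {h : E → ℝ} {zbar zt u z' : E}
    (hprox : IsTensorProx p M Z h zbar zt u) (hh : UniformlyConvex q μ Z h) (hμ : 0 ≤ μ)
    (hz' : z' ∈ Z) : h zt - h z' ≤ ⟪∇ h zt + u, zt - z'⟫ := by
  obtain ⟨⟨hzt, hvi⟩, rfl⟩ := hprox
  have hgrad := hh.add_inner_le hμ hz' hzt
  have hnormal := hvi z' hz'
  rw [← neg_sub z' zt, inner_neg_right, inner_add_left, inner_neg_left]
  linarith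

theorem IsTensorProx.norm_gradient_add_le {p : ℕ} (hp : 1 ≤ p) {L M : ℝ} {Z : Set E} {h : E → ℝ}
    (hZ : Convex ℝ Z) (hL : LipschitzDerivOn p L Z h) {zbar zt u : E} (hzbar : zbar ∈ Z)
    (hprox : IsTensorProx p M Z h zbar zt u) :
    ‖∇ h zt + u + (M / (p ! : ℝ) * ‖zt - zbar‖ ^ (p - 1)) • (zt - zbar)‖ ≤
      L / (p ! : ℝ) * ‖zt - zbar‖ ^ p := by
  obtain ⟨⟨hzt, -⟩, rfl⟩ := hprox
  have hmodel : ∇ h zt + -regularizedModel p (∇ h) M zbar zt +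
      (M / (p ! : ℝ) * ‖zt - zbar‖ ^ (p - 1)) • (zt - zbar) =
        ∇ h zt - taylorField p (∇ h) zbar zt := by
    rw [regularizedModel]
    abel
  rw [hmodel]
  exact norm_gradient_sub_taylorField_le hp hZ hL hzbar hzt

end Convexity

section Iteration

variable {E : Type*}

/-- The invariants of the state at the beginning of iteration `t` of an epoch over `Z`. -/
structure IterState.Valid (Z : Set E) (t : ℕ) (s : IterState E) : Prop where
  z_mem : s.z ∈ Z
  v_mem : s.v ∈ Z
  zt_mem : s.zt ∈ Z
  A_nonneg : 0 ≤ s.A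
  lam'_nonneg : 0 ≤ s.lam'
  A_eq_zero : t = 0 → s.A = 0

theorem IterState.valid_init {Z : Set E} {z : E} (hz : z ∈ Z) : (IterState.init z).Valid Z 0 :=
  ⟨hz, hz, hz, le_rfl, zero_le_one, fun _ => rfl⟩

theorem eq_of_add_eq_two_mul_sq {A lam a b : ℝ} (hA : 0 ≤ A) (ha : 0 < a) (hb : 0 < b)
    (heqa : A + a = 2 * lam * a ^ 2) (heqb : A + b = 2 * lam * b ^ 2) : a = b := by
  have one_le : ∀ x : ℝ, 0 < x → A + x = 2 * lam * x ^ 2 → 1 ≤ 2 * lam * x := fun x hx heq =>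
    le_of_mul_le_mul_right (by linarith) hx
  have hprod : (a - b) * (2 * lam * a + 2 * lam * b - 1) = 0 := by linear_combination heqb - heqa
  rcases mul_eq_zero.1 hprod with heq | hsum
  · exact sub_eq_zero.1 heq
  · linarith [one_le a ha heqa, one_le b hb heqb]

theorem exists_add_eq_two_mul_sq {A lam : ℝ} (hA : 0 ≤ A) (hlam : 0 < lam) :
    ∃ a : ℝ, 0 < a ∧ A + a = 2 * lam * a ^ 2 := by
  obtain ⟨x, hx, hdisc⟩ : ∃ x : ℝ, 0 ≤ x ∧ x ^ 2 = 1 + 8 * lam * A :=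
    ⟨√(1 + 8 * lam * A), Real.sqrt_nonneg _, Real.sq_sqrt (by positivity)⟩
  refine ⟨(1 + x) / (4 * lam), by positivity, ?_⟩
  field_simp
  linear_combination (-2 : ℝ) * hdisc

/-- The factor `γ_{t+1}` of the method, by which a step with `λ_{t+1} > λ'_{t+1}` is shortened. -/
noncomputable def dampingFactor (lam lam' : ℝ) : ℝ :=
  if lam ≤ lam' then 1 else lam' / lam

theorem dampingFactor_pos {lam lam' : ℝ} (hlam' : 0 < lam') : 0 < dampingFactor lam lam' := by
  unfold dampingFactor
  split_ifs with hle
  exacts [one_pos, div_pos hlam' (hlam'.trans (not_le.1 hle))]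

theorem dampingFactor_le_one {lam lam' : ℝ} (hlam' : 0 ≤ lam') : dampingFactor lam lam' ≤ 1 := by
  unfold dampingFactor
  split_ifs with hle
  exacts [le_rfl, div_le_one_of_le₀ (not_le.1 hle).le (hlam'.trans (not_le.1 hle).le)]

theorem dampingFactor_mul_le {lam lam' : ℝ} (hlam' : 0 ≤ lam') :
    dampingFactor lam lam' * lam ≤ lam' := by
  unfold dampingFactor
  split_ifs with hle
  · rwa [one_mul]
  · exact (div_mul_cancel₀ _ (hlam'.trans_lt (not_le.1 hle)).ne').le

variable [NormedAddCommGroup E]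

/-- The energy of a state relative to `zstar`; up to the length of the tensor step, it is a
Lyapunov function of an epoch. -/
noncomputable def IterState.energy (h : E → ℝ) (zstar : E) (s : IterState E) : ℝ :=
  s.A * (h s.z - h zstar) + 1 / 2 * ‖s.v - zstar‖ ^ 2

theorem IterState.mul_sub_le_energy {h : E → ℝ} (zstar : E) (s : IterState E) :
    s.A * (h s.z - h zstar) ≤ s.energy h zstar :=
  le_add_of_nonneg_right (by positivity)

theorem IterState.Valid.energy_nonneg {Z : Set E} {h : E → ℝ} {zstar : E}
    (hmin : IsMinOn h Z zstar) {t : ℕ} {s : IterState E} (hs : s.Valid Z t) :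
    0 ≤ s.energy h zstar :=
  add_nonneg (mul_nonneg hs.A_nonneg (sub_nonneg.2 (hmin hs.z_mem))) (by positivity)

variable [InnerProductSpace ℝ E] [CompleteSpace E]

variable {p : ℕ} {M γ : ℝ} {Z : Set E} {h : E → ℝ} {t : ℕ} {s s' : IterState E}

/-- The transition `s ↦ s'` is an iteration at which the epoch halts. This happens only in
iteration `0`, where `z̄_0` is `s.v`. -/
structure IsHaltingIteration (p : ℕ) (M γ : ℝ) (Z : Set E) (h : E → ℝ) (s s' : IterState E)
    (u : E) : Prop where
  prox : IsTensorProx p M Z h s.v s'.zt u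
  mul_norm_pow_eq_zero : γ * ‖s'.zt - s.v‖ ^ (p - 1) = 0
  z_eq : s'.z = s'.zt
  v_eq : s'.v = s.v
  A_eq : s'.A = s.A
  lam'_eq : s'.lam' = 0

/-- The transition `s ↦ s'` is an iteration that does not halt, with the number `lam'` in the role
of `λ'_{t+1}`. The convex combinations of `IsIteration` are stated without denominators. -/
structure IsRegularIteration (p : ℕ) (M γ : ℝ) (Z : Set E) (h : E → ℝ) (s s' : IterState E)
    (lam lam' a' gam : ℝ) (zbar u : E) : Prop where
  lam_eq : lam = γ * ‖s'.zt - zbar‖ ^ (p - 1)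
  lam'_pos : 0 < lam'
  a'_pos : 0 < a'
  add_eq : s.A + a' = 2 * lam' * a' ^ 2
  smul_zbar : (s.A + a') • zbar = s.A • s.z + a' • s.v
  prox : IsTensorProx p M Z h zbar s'.zt u
  gam_eq : gam = dampingFactor lam lam'
  A_eq : s'.A = s.A + gam * a'
  smul_z : s'.A • s'.z = ((1 - gam) * s.A) • s.z + (gam * (s.A + a')) • s'.zt
  proj : IsProj Z (s.v - (gam * a') • (∇ h s'.zt + u)) s'.v
  lam'_eq : s'.lam' = if lam ≤ lam' then lam' / 2 else 2 * lam'

theorem IsIteration.eq_of_halted (hit : IsIteration p M γ Z h t s s') (hs : s.lam' = 0) :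
    s' = s := by
  rwa [IsIteration, if_pos hs] at hit

theorem IsIteration.halting_or_regular (hγ : 0 ≤ γ) (hs : s.Valid Z t) (hs0 : s.lam' ≠ 0)
    (hit : IsIteration p M γ Z h t s s') :
    (t = 0 ∧ ∃ u, IsHaltingIteration p M γ Z h s s' u) ∨
      ∃ lam lam' a' gam : ℝ, ∃ zbar u : E,
        IsRegularIteration p M γ Z h s s' lam lam' a' gam zbar u ∧
          lam' = if t = 0 then lam else s.lam' := by
  rw [IsIteration, if_neg hs0] at hit
  obtain ⟨a₀, zbar, zt, u, ha₀, heq₀, hzbar, hprox, hit⟩ := hit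
  have hA := hs.A_nonneg
  have hzbar_init : t = 0 → zbar = s.v := fun ht => by
    simp [hzbar, hs.A_eq_zero ht, ha₀.ne']
  simp only at hit
  set lam := γ * ‖zt - zbar‖ ^ (p - 1)
  by_cases hzero : (if t = 0 then lam else s.lam') = 0
  · rw [if_pos hzero] at hit
    have ht : t = 0 := by
      by_contra ht
      exact hs0 (by rwa [if_neg ht] at hzero)
    rw [if_pos ht] at hzero
    obtain rfl := hzbar_init ht
    subst hit
    exact Or.inl ⟨ht, u, hprox, hzero, rfl, rfl, rfl, rfl⟩
  · rw [if_neg hzero] at hit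
    obtain ⟨a', v', ha', heq, hv', rfl⟩ := hit
    have hlam' : 0 < if t = 0 then lam else s.lam' := by
      refine lt_of_le_of_ne ?_ (Ne.symm hzero)
      split_ifs
      exacts [by positivity, hs.lam'_nonneg]
    have hsmul_zbar : (s.A + a') • zbar = s.A • s.z + a' • s.v := by
      by_cases ht : t = 0
      · rw [hzbar_init ht, hs.A_eq_zero ht, zero_add, zero_smul, zero_add]
      · rw [if_neg ht] at heq
        obtain rfl := eq_of_add_eq_two_mul_sq hA ha' ha₀ heq heq₀
        rw [hzbar, smul_add, smul_smul, smul_smul, mul_div_cancel₀ _ (by positivity),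
          mul_div_cancel₀ _ (by positivity)]
    have hgam := dampingFactor_pos (lam := lam) hlam'
    unfold dampingFactor at hgam
    refine Or.inr ⟨_, _, a', _, zbar, u,
      ⟨rfl, hlam', ha', heq, hsmul_zbar, hprox, rfl, rfl, ?_, hv', rfl⟩, rfl⟩
    rw [smul_add, smul_smul, smul_smul, mul_div_cancel₀ _ (by positivity),
      mul_div_cancel₀ _ (by positivity)]
    rfl

theorem IsIteration.length_queries_le (hit : IsIteration p M γ Z h t s s') :
    s'.queries.length ≤ s.queries.length + 4 := by
  by_cases hs0 : s.lam' = 0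
  · rw [hit.eq_of_halted hs0]
    exact Nat.le_add_right _ _
  · rw [IsIteration, if_neg hs0] at hit
    obtain ⟨a₀, zbar, zt, u, -, -, -, -, hit⟩ := hit
    simp only at hit
    by_cases hzero : (if t = 0 then γ * ‖zt - zbar‖ ^ (p - 1) else s.lam') = 0
    · rw [if_pos hzero] at hit
      simp [hit]
    · rw [if_neg hzero] at hit
      obtain ⟨a', v', -, -, -, rfl⟩ := hit
      simp

theorem IsHaltingIteration.valid {u : E} (hit : IsHaltingIteration p M γ Z h s s' u)
    (hs : s.Valid Z t) : s'.Valid Z (t + 1) where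
  z_mem := hit.z_eq ▸ hit.prox.1.1
  v_mem := hit.v_eq ▸ hs.v_mem
  zt_mem := hit.prox.1.1
  A_nonneg := hit.A_eq ▸ hs.A_nonneg
  lam'_nonneg := hit.lam'_eq.ge
  A_eq_zero := nofun

theorem IsHaltingIteration.apply_zt_le (hp : 1 ≤ p) (hγ : 0 < γ) (hZ : Convex ℝ Z) {q : ℕ}
    {μ L : ℝ} (hμ : 0 ≤ μ) (hh : UniformlyConvex q μ Z h) (hLip : LipschitzDerivOn p L Z h)
    {u z' : E} (hit : IsHaltingIteration p M γ Z h s s' u) (hv : s.v ∈ Z) (hz' : z' ∈ Z) :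
    h s'.zt ≤ h z' := by
  have hpow : ‖s'.zt - s.v‖ ^ (p - 1) = 0 :=
    (mul_eq_zero.1 hit.mul_norm_pow_eq_zero).resolve_left hγ.ne'
  have hgrad : ∇ h s'.zt + u = 0 := by
    have hle := hit.prox.norm_gradient_add_le hp hZ hLip hv
    rw [hpow, mul_zero, zero_smul, add_zero, eq_zero_of_pow_eq_zero hpow, zero_pow (by omega),
      mul_zero] at hle
    exact norm_le_zero_iff.1 hle
  have hgap := hit.prox.sub_le_inner hh hμ hz'
  rw [hgrad, inner_zero_left] at hgap
  exact sub_nonpos.1 hgap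

namespace IsRegularIteration

variable {lam lam' a' gam : ℝ} {zbar u : E}

theorem gam_pos (hit : IsRegularIteration p M γ Z h s s' lam lam' a' gam zbar u) : 0 < gam :=
  hit.gam_eq ▸ dampingFactor_pos hit.lam'_pos

theorem gam_le_one (hit : IsRegularIteration p M γ Z h s s' lam lam' a' gam zbar u) : gam ≤ 1 :=
  hit.gam_eq ▸ dampingFactor_le_one hit.lam'_pos.le

theorem gam_mul_lam_le (hit : IsRegularIteration p M γ Z h s s' lam lam' a' gam zbar u) :
    gam * lam ≤ lam' :=
  hit.gam_eq ▸ dampingFactor_mul_le hit.lam'_pos.le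

theorem A_pos (hit : IsRegularIteration p M γ Z h s s' lam lam' a' gam zbar u)
    (hs : s.Valid Z t) : 0 < s'.A :=
  hit.A_eq ▸ add_pos_of_nonneg_of_pos hs.A_nonneg (mul_pos hit.gam_pos hit.a'_pos)

theorem lam'_pos_succ (hit : IsRegularIteration p M γ Z h s s' lam lam' a' gam zbar u) :
    0 < s'.lam' := by
  have := hit.lam'_pos
  rw [hit.lam'_eq]
  split_ifs <;> positivity

theorem A_le (hit : IsRegularIteration p M γ Z h s s' lam lam' a' gam zbar u) : s.A ≤ s'.A :=
  hit.A_eq ▸ le_add_of_nonneg_right (mul_pos hit.gam_pos hit.a'_pos).le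

theorem zbar_mem (hit : IsRegularIteration p M γ Z h s s' lam lam' a' gam zbar u)
    (hZ : Convex ℝ Z) (hs : s.Valid Z t) : zbar ∈ Z :=
  mem_of_convex_of_smul_eq hZ hs.z_mem hs.v_mem hs.A_nonneg hit.a'_pos.le
    (add_pos_of_nonneg_of_pos hs.A_nonneg hit.a'_pos) rfl hit.smul_zbar

theorem valid (hit : IsRegularIteration p M γ Z h s s' lam lam' a' gam zbar u)
    (hZ : Convex ℝ Z) (hs : s.Valid Z t) : s'.Valid Z (t + 1) where
  z_mem :=
    mem_of_convex_of_smul_eq hZ hs.z_mem hit.prox.1.1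
      (mul_nonneg (sub_nonneg.2 hit.gam_le_one) hs.A_nonneg)
      (mul_nonneg hit.gam_pos.le (add_nonneg hs.A_nonneg hit.a'_pos.le)) (hit.A_pos hs)
      (by rw [hit.A_eq]; ring) hit.smul_z
  v_mem := hit.proj.1
  zt_mem := hit.prox.1.1
  A_nonneg := (hit.A_pos hs).le
  lam'_nonneg := hit.lam'_pos_succ.le
  A_eq_zero := nofun

theorem mul_sub_le {q : ℕ} {μ : ℝ} (hμ : 0 ≤ μ) (hh : UniformlyConvex q μ Z h) (hZ : Convex ℝ Z)
    (hit : IsRegularIteration p M γ Z h s s' lam lam' a' gam zbar u) (hs : s.Valid Z t) {x : E}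
    (hx : x ∈ Z) :
    s'.A * (h s'.z - h x) ≤ s.A * (h s.z - h x) + gam * ((s.A + a') *
      ⟪∇ h s'.zt + u, s'.zt - zbar⟫ + a' * ⟪∇ h s'.zt + u, s.v - x⟫) := by
  set g := ∇ h s'.zt + u
  have hA := hs.A_nonneg
  have ha' := hit.a'_pos
  have hgam := hit.gam_pos
  have hjensen : s'.A * h s'.z ≤ (1 - gam) * s.A * h s.z + gam * (s.A + a') * h s'.zt :=
    mul_le_of_convexOn_of_smul_eq (hh.convexOn hμ hZ) hs.z_mem hit.prox.1.1
      (mul_nonneg (sub_nonneg.2 hit.gam_le_one) hA) (by positivity) (hit.A_pos hs)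
      (by rw [hit.A_eq]; ring) hit.smul_z
  have hlinear : s.A * (h s'.zt - h s.z) + a' * (h s'.zt - h x) ≤
      s.A * ⟪g, s'.zt - s.z⟫ + a' * ⟪g, s'.zt - x⟫ := by
    gcongr
    exacts [hit.prox.sub_le_inner hh hμ hs.z_mem, hit.prox.sub_le_inner hh hμ hx]
  have hcoupling : s.A * ⟪g, s'.zt - s.z⟫ + a' * ⟪g, s'.zt - x⟫ =
      (s.A + a') * ⟪g, s'.zt - zbar⟫ + a' * ⟪g, s.v - x⟫ := by
    have hinner := congrArg (fun y => ⟪g, y⟫) hit.smul_zbar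
    simp only [inner_add_right, real_inner_smul_right] at hinner
    simp only [inner_sub_right]
    linear_combination hinner
  rw [hcoupling] at hlinear
  have hscaled := mul_le_mul_of_nonneg_left hlinear hgam.le
  have hA_eq : s'.A * h x = (s.A + gam * a') * h x := by rw [hit.A_eq]
  linarith

theorem energy_add_le (hp : 1 ≤ p) {L μ : ℝ} (hL : 0 ≤ L) (hμ : 0 ≤ μ) (hZ : Convex ℝ Z) {q : ℕ}
    (hh : UniformlyConvex q μ Z h) (hLip : LipschitzDerivOn p L Z h)
    (hit : IsRegularIteration p (2 * L) L Z h s s' lam lam' a' gam zbar u) (hs : s.Valid Z t)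
    {x : E} (hx : x ∈ Z) :
    s'.energy h x + 3 / 4 * (gam * (s.A + a') * (lam / (p ! : ℝ)) * ‖s'.zt - zbar‖ ^ 2) ≤
      s.energy h x := by
  have hA := hs.A_nonneg
  have ha' := hit.a'_pos
  have hgam := hit.gam_pos
  have hlam : 0 ≤ lam := hit.lam_eq ▸ by positivity
  set g := ∇ h s'.zt + u
  set r := ‖s'.zt - zbar‖
  have hprox : ‖g + (2 * (lam / (p ! : ℝ))) • (s'.zt - zbar)‖ ≤ lam / (p ! : ℝ) * r := by
    have hle := hit.prox.norm_gradient_add_le hp hZ hLip (hit.zbar_mem hZ hs)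
    convert hle using 1
    · rw [hit.lam_eq]
      congr 3
      ring
    · rw [hit.lam_eq, ← pow_sub_one_mul (by lia : p ≠ 0)]
      ring
  have hdescent : ⟪g, s'.zt - zbar⟫ + gam / (4 * lam') * ‖g‖ ^ 2 ≤
      -(3 / 4 * (lam / (p ! : ℝ)) * r ^ 2) := by
    refine inner_add_sq_le_of_norm_add_smul_le (by positivity) hit.lam'_pos ?_ hprox
    exact (mul_le_mul_of_nonneg_left (div_le_self hlam (mod_cast p.factorial_pos)) hgam.le).trans
      hit.gam_mul_lam_le
  have hsquare : gam * (s.A + a') * (gam / (4 * lam') * ‖g‖ ^ 2) =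
      1 / 2 * ((gam * a') ^ 2 * ‖g‖ ^ 2) := by
    have := hit.lam'_pos
    rw [hit.add_eq]
    field_simp
    ring
  have hscaled := mul_le_mul_of_nonneg_left hdescent (by positivity : 0 ≤ gam * (s.A + a'))
  rw [mul_add, hsquare] at hscaled
  have hgap := hit.mul_sub_le hμ hh hZ hs hx
  have hdist := hit.proj.norm_sub_sq_le_of_sub_smul hZ hx
  unfold IterState.energy
  linarith

theorem energy_le (hp : 1 ≤ p) {L μ : ℝ} (hL : 0 ≤ L) (hμ : 0 ≤ μ) (hZ : Convex ℝ Z) {q : ℕ}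
    (hh : UniformlyConvex q μ Z h) (hLip : LipschitzDerivOn p L Z h)
    (hit : IsRegularIteration p (2 * L) L Z h s s' lam lam' a' gam zbar u) (hs : s.Valid Z t)
    {x : E} (hx : x ∈ Z) : s'.energy h x ≤ s.energy h x := by
  have hA := hs.A_nonneg
  have ha' := hit.a'_pos
  have hgam := hit.gam_pos
  have hlam : 0 ≤ lam := hit.lam_eq ▸ by positivity
  exact (le_add_of_nonneg_right (by positivity)).trans
    (hit.energy_add_le hp hL hμ hZ hh hLip hs hx)

theorem energy_add_le_of_lt (hp : 1 ≤ p) {L μ : ℝ} (hL : 0 ≤ L) (hμ : 0 ≤ μ) (hZ : Convex ℝ Z)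
    {q : ℕ} (hh : UniformlyConvex q μ Z h) (hLip : LipschitzDerivOn p L Z h)
    (hit : IsRegularIteration p (2 * L) L Z h s s' lam lam' a' gam zbar u) (hs : s.Valid Z t)
    {x : E} (hx : x ∈ Z) (hlt : lam' < lam) :
    s'.energy h x + 3 / 4 * (s.A * (lam' / (p ! : ℝ)) * ‖s'.zt - zbar‖ ^ 2) ≤ s.energy h x := by
  have hlam' := hit.lam'_pos
  have hgam_lam : gam * lam = lam' := by
    rw [hit.gam_eq, dampingFactor, if_neg hlt.not_ge, div_mul_cancel₀ _ (hlam'.trans hlt).ne']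
  refine le_trans ?_ (hit.energy_add_le hp hL hμ hZ hh hLip hs hx)
  rw [show gam * (s.A + a') * (lam / (p ! : ℝ)) = (s.A + a') * (lam' / (p ! : ℝ)) by
    rw [← hgam_lam]; ring]
  gcongr
  exact le_add_of_nonneg_right hit.a'_pos.le

end IsRegularIteration

theorem IsIteration.valid (hγ : 0 ≤ γ) (hZ : Convex ℝ Z) (hs : s.Valid Z t)
    (hit : IsIteration p M γ Z h t s s') : s'.Valid Z (t + 1) := by
  by_cases hs0 : s.lam' = 0
  · rw [hit.eq_of_halted hs0]
    exact { hs with A_eq_zero := nofun }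
  · rcases hit.halting_or_regular hγ hs hs0 with ⟨-, u, hhalt⟩ | ⟨_, _, _, _, _, _, hreg, -⟩
    exacts [hhalt.valid hs, hreg.valid hZ hs]

theorem IsIteration.exists_isRegularIteration (hγ : 0 ≤ γ) (hs : s.Valid Z t) (hs0 : s.lam' ≠ 0)
    (ht : t ≠ 0) (hit : IsIteration p M γ Z h t s s') :
    ∃ lam a' gam : ℝ, ∃ zbar u : E,
      IsRegularIteration p M γ Z h s s' lam s.lam' a' gam zbar u := by
  rcases hit.halting_or_regular hγ hs hs0 with ⟨ht0, -⟩ | ⟨lam, _, a', gam, zbar, u, hreg, rfl⟩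
  · exact absurd ht0 ht
  · rw [if_neg ht] at hreg
    exact ⟨lam, a', gam, zbar, u, hreg⟩

theorem IsIteration.energy_le (hp : 1 ≤ p) {L μ : ℝ} (hL : 0 ≤ L) (hμ : 0 ≤ μ) (hZ : Convex ℝ Z)
    {q : ℕ} (hh : UniformlyConvex q μ Z h) (hLip : LipschitzDerivOn p L Z h) (hs : s.Valid Z t)
    (hit : IsIteration p (2 * L) L Z h t s s') {x : E} (hx : x ∈ Z) :
    s'.energy h x ≤ s.energy h x := by
  by_cases hs0 : s.lam' = 0
  · rw [hit.eq_of_halted hs0]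
  rcases hit.halting_or_regular hL hs hs0 with
    ⟨ht, u, hhalt⟩ | ⟨lam, lam', a', gam, zbar, u, hreg, -⟩
  · rw [IterState.energy, IterState.energy, hhalt.A_eq, hhalt.v_eq, hs.A_eq_zero ht, zero_mul,
      zero_mul]
  · exact hreg.energy_le hp hL hμ hZ hh hLip hs hx

theorem exists_isIteration [ProperSpace E] (hp : 1 ≤ p) (hM : 0 < M) (hγ : 0 ≤ γ)
    (hZc : IsClosed Z) (hZ : Convex ℝ Z) (hh : ∀ z ∈ Z, ContDiffAt ℝ p h z) (hs : s.Valid Z t) :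
    ∃ s', IsIteration p M γ Z h t s s' := by
  by_cases hs0 : s.lam' = 0
  · exact ⟨s, by rw [IsIteration, if_pos hs0]⟩
  have hA := hs.A_nonneg
  obtain ⟨a₀, ha₀, heq₀⟩ := exists_add_eq_two_mul_sq hA (lt_of_le_of_ne' hs.lam'_nonneg hs0)
  obtain ⟨zbar, hzbar⟩ : ∃ zbar, zbar = (s.A / (s.A + a₀)) • s.z + (a₀ / (s.A + a₀)) • s.v :=
    ⟨_, rfl⟩
  have hzbarZ : zbar ∈ Z :=
    hzbar ▸ hZ hs.z_mem hs.v_mem (by positivity) (by positivity) (by field_simp)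
  obtain ⟨zt, hzt⟩ := exists_isTensorStep hp hZc hZ hM hzbarZ (hh _ hzbarZ)
  simp only [IsIteration, if_neg hs0]
  by_cases hzero : (if t = 0 then γ * ‖zt - zbar‖ ^ (p - 1) else s.lam') = 0
  · exact ⟨_, a₀, zbar, zt, _, ha₀, heq₀, hzbar, ⟨hzt, rfl⟩, (if_pos hzero).mpr rfl⟩
  · have hlam' : 0 ≤ if t = 0 then γ * ‖zt - zbar‖ ^ (p - 1) else s.lam' := by
      split_ifs
      exacts [by positivity, hs.lam'_nonneg]
    obtain ⟨a', ha', heq⟩ := exists_add_eq_two_mul_sq hA (lt_of_le_of_ne' hlam' hzero)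
    obtain ⟨v', hv'⟩ := exists_isProj hZc hZ ⟨_, hzbarZ⟩ _
    exact ⟨_, a₀, zbar, zt, _, ha₀, heq₀, hzbar, ⟨hzt, rfl⟩,
      (if_neg hzero).mpr ⟨a', v', ha', heq, hv', rfl⟩⟩

end Iteration

section Growth

/-- The exponent `b = 2 / (3p + 1)` of the condition number in the iteration count; after `t`
iterations the weight `A_t` is at least of order `t ^ (1 / b)`. -/
noncomputable def rateExponent (p : ℕ) : ℝ :=
  2 / (3 * p + 1)

theorem rateExponent_pos (p : ℕ) : 0 < rateExponent p := by
  unfold rateExponent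
  positivity

theorem rateExponent_le_half {p : ℕ} (hp : 1 ≤ p) : rateExponent p ≤ 1 / 2 := by
  have hp' : (1 : ℝ) ≤ p := mod_cast hp
  rw [rateExponent, div_le_div_iff₀ (by positivity) two_pos]
  linarith

theorem one_sub_two_mul_rateExponent {p : ℕ} (hp : 1 ≤ p) :
    1 - 2 * rateExponent p = 3 / 2 * rateExponent p * (p - 1 : ℕ) := by
  rw [rateExponent, Nat.cast_sub hp]
  field_simp
  push_cast
  ring

theorem div_three_le_rpow_sub_rpow {b lam Y a : ℝ} (hb : 0 < b) (hb1 : b ≤ 1) (hY : 0 ≤ Y)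
    (ha : 0 < a) (heq : Y + a = lam * a ^ 2) (hlow : lam * (Y + a) ^ (1 - 2 * b) ≤ 8) :
    b / 3 ≤ (Y + a) ^ b - Y ^ b := by
  have hY' : 0 < Y + a := by positivity
  have hle : (Y + a) ^ (1 - b) ≤ 3 * a := by
    refine (sq_le_sq₀ (by positivity) (by positivity)).1 ?_
    have hsplit : ((Y + a) ^ (1 - b)) ^ 2 = (Y + a) ^ (1 - 2 * b) * (Y + a) := by
      rw [← Real.rpow_mul_natCast hY'.le, ← Real.rpow_add_one hY'.ne']
      congr 1
      push_cast
      ring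
    calc ((Y + a) ^ (1 - b)) ^ 2 = lam * (Y + a) ^ (1 - 2 * b) * a ^ 2 := by
          rw [hsplit]
          linear_combination (Y + a) ^ (1 - 2 * b) * heq
      _ ≤ 8 * a ^ 2 := by gcongr
      _ ≤ (3 * a) ^ 2 := by linarith [sq_nonneg a]
  have hbernoulli : (Y / (Y + a)) ^ b ≤ 1 + b * (Y / (Y + a) - 1) := by
    simpa using rpow_one_add_le_one_add_mul_self (s := Y / (Y + a) - 1)
      (by linarith [show 0 ≤ Y / (Y + a) by positivity]) hb.le hb1
  have hpow : (Y + a) ^ b * (Y + a) ^ (1 - b) = Y + a := by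
    rw [← Real.rpow_add hY', add_sub_cancel, Real.rpow_one]
  calc b / 3 = b / 3 * ((Y + a) ^ b * (Y + a) ^ (1 - b) / (Y + a)) := by
        rw [hpow, div_self hY'.ne', mul_one]
    _ = (Y + a) ^ b * (b * ((Y + a) ^ (1 - b) / 3) / (Y + a)) := by ring
    _ ≤ (Y + a) ^ b * (b * a / (Y + a)) := by gcongr; linarith
    _ = (Y + a) ^ b * (1 - (1 + b * (Y / (Y + a) - 1))) := by field_simp; ring
    _ ≤ (Y + a) ^ b * (1 - (Y / (Y + a)) ^ b) := by gcongr
    _ = (Y + a) ^ b - Y ^ b := by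
      rw [Real.div_rpow hY hY'.le, mul_sub, mul_one, mul_div_cancel₀ _ (by positivity)]

theorem two_le_rpow_mul_of_le_pow {p : ℕ} (hp : 1 ≤ p) {lam Y ρ : ℝ} (hlam : 0 ≤ lam) (hY : 0 < Y)
    (hρ : 0 ≤ ρ) (hlamρ : lam ≤ ρ ^ (p - 1))
    (hhigh : 2 ≤ lam * Y ^ (1 - 2 * rateExponent p)) :
    2 ≤ Y ^ rateExponent p * (Y * lam * ρ ^ 2) := by
  set b := rateExponent p
  have hρlow : Y ^ (-(3 / 2 * b)) ≤ ρ := by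
    by_contra! hlt
    have hpow : lam ≤ Y ^ (-(1 - 2 * b)) := by
      calc lam ≤ (Y ^ (-(3 / 2 * b))) ^ (p - 1) := hlamρ.trans (pow_le_pow_left₀ hρ hlt.le _)
        _ = Y ^ (-(1 - 2 * b)) := by
          rw [← Real.rpow_mul_natCast hY.le, neg_mul, ← one_sub_two_mul_rateExponent hp]
    have hle : lam * Y ^ (1 - 2 * b) ≤ Y ^ (-(1 - 2 * b)) * Y ^ (1 - 2 * b) := by gcongr
    rw [← Real.rpow_add hY, neg_add_cancel, Real.rpow_zero] at hle
    linarith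
  have hexponents : Y ^ b * Y * (Y ^ (-(3 / 2 * b))) ^ 2 = Y ^ (1 - 2 * b) := by
    rw [← Real.rpow_add_one hY.ne', ← Real.rpow_mul_natCast hY.le, ← Real.rpow_add hY]
    congr 1
    push_cast
    ring
  calc 2 ≤ lam * (Y ^ b * Y * (Y ^ (-(3 / 2 * b))) ^ 2) := hexponents ▸ hhigh
    _ ≤ lam * (Y ^ b * Y * ρ ^ 2) := by gcongr
    _ = Y ^ b * (Y * lam * ρ ^ 2) := by ring

/-- The binary logarithm of `lam * Y ^ (1 - 2 * b) / 4`, where `b = rateExponent p`; the guesses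
keep it near zero. -/
noncomputable def imbalance (p : ℕ) (lam Y : ℝ) : ℝ :=
  Real.logb 2 lam + (1 - 2 * rateExponent p) * Real.logb 2 Y - 2

/-- A potential that drops by at least one in each iteration, up to the loss of energy. It is
bounded from below in terms of the weight `Y`, which therefore has to grow. -/
noncomputable def growthPotential (p : ℕ) (lam Y : ℝ) : ℝ :=
  |imbalance p lam Y| - 6 / rateExponent p * Y ^ rateExponent p -
    (1 - 2 * rateExponent p) * Real.logb 2 Y

/-- The scale-free form of an iteration that takes the guess `lam`, the weight `Y` and the energy
`e` to `lam'`, `Y'` and `e'`. If the guess is halved, the weight grows as in a full step; if it is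
doubled, energy is lost in proportion to the square of the (normalized) step length `ρ`. -/
structure GrowthStep (p : ℕ) (lam Y e lam' Y' e' : ℝ) : Prop where
  weight_le : Y ≤ Y'
  energy_le : e' ≤ e
  halving_or_doubling :
    (lam' = lam / 2 ∧ ∃ a > 0, Y' = Y + a ∧ Y' = lam * a ^ 2) ∨
      (lam' = 2 * lam ∧ ∃ ρ ≥ 0, lam ≤ ρ ^ (p - 1) ∧ Y * lam * ρ ^ 2 ≤ e - e')

theorem logb_two_mul_rpow_eq_imbalance {p : ℕ} {lam Y : ℝ} (hlam : 0 < lam) (hY : 0 < Y) :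
    Real.logb 2 (lam * Y ^ (1 - 2 * rateExponent p)) = imbalance p lam Y + 2 := by
  rw [Real.logb_mul hlam.ne' (Real.rpow_pos_of_pos hY _).ne', Real.logb_rpow_eq_mul_logb_of_pos hY,
    imbalance]
  ring

theorem imbalance_half {p : ℕ} {lam Y : ℝ} (hlam : lam ≠ 0) :
    imbalance p (lam / 2) Y = imbalance p lam Y - 1 := by
  rw [imbalance, imbalance, Real.logb_div hlam two_ne_zero, Real.logb_self_eq_one one_lt_two]
  ring

theorem imbalance_double {p : ℕ} {lam Y : ℝ} (hlam : lam ≠ 0) :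
    imbalance p (2 * lam) Y = imbalance p lam Y + 1 := by
  rw [imbalance, imbalance, Real.logb_mul two_ne_zero hlam, Real.logb_self_eq_one one_lt_two]
  ring

theorem growthPotential_half_add_one_le {p : ℕ} (hp : 1 ≤ p) {lam Y a : ℝ} (hlam : 0 < lam)
    (hY : 0 < Y) (ha : 0 < a) (heq : Y + a = lam * a ^ 2) :
    growthPotential p (lam / 2) (Y + a) + 1 ≤ growthPotential p lam Y := by
  have hb := rateExponent_pos p
  have hb2 := rateExponent_le_half hp
  set b := rateExponent p with hbdef
  have hlog : (1 - 2 * b) * Real.logb 2 Y ≤ (1 - 2 * b) * Real.logb 2 (Y + a) := by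
    gcongr <;> linarith
  have himb : imbalance p lam (Y + a) = imbalance p lam Y +
      ((1 - 2 * b) * Real.logb 2 (Y + a) - (1 - 2 * b) * Real.logb 2 Y) := by
    simp only [imbalance, ← hbdef]
    ring
  have hgain : 6 / b * Y ^ b ≤ 6 / b * (Y + a) ^ b := by gcongr; linarith
  have habs : |imbalance p lam (Y + a) - 1| + 1 ≤ |imbalance p lam Y| +
      (6 / b * (Y + a) ^ b - 6 / b * Y ^ b) +
        ((1 - 2 * b) * Real.logb 2 (Y + a) - (1 - 2 * b) * Real.logb 2 Y) := by
    rcases le_or_gt (imbalance p lam (Y + a)) 1 with hlow | hhigh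
    · have hpow : lam * (Y + a) ^ (1 - 2 * b) ≤ 8 := by
        have hle : Real.logb 2 (lam * (Y + a) ^ (1 - 2 * b)) ≤ (3 : ℕ) := by
          rw [hbdef, logb_two_mul_rpow_eq_imbalance hlam (by positivity)]
          push_cast
          linarith
        rw [Real.logb_le_iff_le_rpow one_lt_two (by positivity), Real.rpow_natCast] at hle
        linarith
      have hjump : 2 ≤ 6 / b * (Y + a) ^ b - 6 / b * Y ^ b := by
        calc 2 = 6 / b * (b / 3) := by field_simp; norm_num
          _ ≤ 6 / b * ((Y + a) ^ b - Y ^ b) := by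
            gcongr
            exact div_three_le_rpow_sub_rpow hb (by linarith) hY.le ha heq hpow
          _ = _ := by ring
      grind
    · grind
  rw [growthPotential, growthPotential, imbalance_half hlam.ne']
  linarith

theorem growthPotential_double_add_one_le {p : ℕ} (hp : 1 ≤ p) {lam Y Y' ρ : ℝ} (hlam : 0 < lam)
    (hY : 0 < Y) (hYY' : Y ≤ Y') (hρ : 0 ≤ ρ) (hlamρ : lam ≤ ρ ^ (p - 1)) :
    growthPotential p (2 * lam) Y' + 1 ≤
      growthPotential p lam Y + Y ^ rateExponent p * (Y * lam * ρ ^ 2) := by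
  have hb := rateExponent_pos p
  have hb2 := rateExponent_le_half hp
  set b := rateExponent p with hbdef
  have hlog : (1 - 2 * b) * Real.logb 2 Y ≤ (1 - 2 * b) * Real.logb 2 Y' := by
    gcongr <;> linarith
  have himb : imbalance p lam Y' = imbalance p lam Y +
      ((1 - 2 * b) * Real.logb 2 Y' - (1 - 2 * b) * Real.logb 2 Y) := by
    simp only [imbalance, ← hbdef]
    ring
  have hgain : 6 / b * Y ^ b ≤ 6 / b * Y' ^ b := by gcongr
  have habs : |imbalance p lam Y' + 1| + 1 ≤ |imbalance p lam Y| + Y ^ b * (Y * lam * ρ ^ 2) +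
      ((1 - 2 * b) * Real.logb 2 Y' - (1 - 2 * b) * Real.logb 2 Y) := by
    rcases le_or_gt (-1) (imbalance p lam Y) with hhigh | hlow
    · have hpow : 2 ≤ lam * Y ^ (1 - 2 * b) := by
        have hle : 1 ≤ Real.logb 2 (lam * Y ^ (1 - 2 * b)) := by
          rw [hbdef, logb_two_mul_rpow_eq_imbalance hlam hY]
          linarith
        rwa [Real.le_logb_iff_rpow_le one_lt_two (by positivity), Real.rpow_one] at hle
      have hloss := two_le_rpow_mul_of_le_pow hp hlam.le hY hρ hlamρ hpow
      grind
    · have hloss : 0 ≤ Y ^ b * (Y * lam * ρ ^ 2) := by positivity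
      grind
  rw [growthPotential, growthPotential, imbalance_double hlam.ne']
  linarith

theorem GrowthStep.growthPotential_add_one_le {p : ℕ} (hp : 1 ≤ p) {lam Y e lam' Y' e' W : ℝ}
    (hlam : 0 < lam) (hY : 0 < Y) (hYW : Y ≤ W) (hstep : GrowthStep p lam Y e lam' Y' e') :
    growthPotential p lam' Y' + 1 ≤ growthPotential p lam Y + W ^ rateExponent p * (e - e') := by
  have hdrop := sub_nonneg.2 hstep.energy_le
  have hW := hY.trans_le hYW
  rcases hstep.halving_or_doubling with ⟨rfl, a, ha, rfl, heq⟩ | ⟨rfl, ρ, hρ, hlamρ, hloss⟩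
  · exact (growthPotential_half_add_one_le hp hlam hY ha heq).trans
      (le_add_of_nonneg_right (by positivity))
  · refine (growthPotential_double_add_one_le hp hlam hY hstep.weight_le hρ hlamρ).trans ?_
    have hb := rateExponent_pos p
    gcongr

theorem GrowthStep.guess_pos {p : ℕ} {lam Y e lam' Y' e' : ℝ}
    (hstep : GrowthStep p lam Y e lam' Y' e') (hlam : 0 < lam) : 0 < lam' := by
  rcases hstep.halving_or_doubling with ⟨rfl, -⟩ | ⟨rfl, -⟩ <;> positivity

theorem logb_two_le_two_div_mul_rpow {b Y : ℝ} (hb : 0 < b) (hY : 1 ≤ Y) :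
    Real.logb 2 Y ≤ 2 / b * Y ^ b := by
  have hlog2 : (1 / 2 : ℝ) ≤ Real.log 2 := by linarith [Real.log_two_gt_d9]
  rw [Real.logb, div_le_iff₀ (by linarith)]
  calc Real.log Y ≤ Y ^ b / b := Real.log_le_rpow_div (zero_le_one.trans hY) hb
    _ = 2 / b * Y ^ b * (1 / 2) := by ring
    _ ≤ 2 / b * Y ^ b * Real.log 2 := by gcongr

theorem neg_mul_rpow_le_growthPotential {p : ℕ} {lam Y : ℝ} (hY : 1 ≤ Y) :
    -(8 / rateExponent p * Y ^ rateExponent p) ≤ growthPotential p lam Y := by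
  have hb := rateExponent_pos p
  have hlog := logb_two_le_two_div_mul_rpow hb hY
  have hlog0 := mul_nonneg hb.le (Real.logb_nonneg one_lt_two hY)
  have habs := abs_nonneg (imbalance p lam Y)
  have hsplit : 8 / rateExponent p * Y ^ rateExponent p =
      6 / rateExponent p * Y ^ rateExponent p + 2 / rateExponent p * Y ^ rateExponent p := by ring
  rw [growthPotential]
  linarith

theorem growthPotential_le_three {p : ℕ} (hp : 1 ≤ p) {lam Y : ℝ} (hlam : 0 < lam) (hY : 1 ≤ Y)
    (hprod : Y * lam = 1 / 2) : growthPotential p lam Y ≤ 3 := by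
  have hb := rateExponent_pos p
  have hb2 := rateExponent_le_half hp
  have hY0 : 0 < Y := by positivity
  have hlogY := Real.logb_nonneg one_lt_two hY
  have hlogs : Real.logb 2 Y + Real.logb 2 lam = -1 := by
    rw [← Real.logb_mul hY0.ne' hlam.ne', hprod, one_div, Real.logb_inv,
      Real.logb_self_eq_one one_lt_two]
  have himb : imbalance p lam Y = -(3 + 2 * rateExponent p * Real.logb 2 Y) := by
    rw [imbalance]
    linear_combination hlogs
  have hlog := logb_two_le_two_div_mul_rpow hb hY
  have hrpow : 2 / rateExponent p * Y ^ rateExponent p ≤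
      6 / rateExponent p * Y ^ rateExponent p := by gcongr; norm_num
  rw [growthPotential, himb, abs_neg, abs_of_nonneg (by positivity)]
  have hcoef := mul_le_mul_of_nonneg_right hb2 hlogY
  linarith

theorem succ_le_mul_rpow_of_growthStep {p : ℕ} (hp : 1 ≤ p) {n : ℕ} {Y lam e : ℕ → ℝ}
    (hY0 : 1 ≤ Y 0) (hlam0 : 0 < lam 0) (hprod : Y 0 * lam 0 = 1 / 2) (he0 : e 0 ≤ 1)
    (hen : 0 ≤ e n)
    (hstep : ∀ t < n, GrowthStep p (lam t) (Y t) (e t) (lam (t + 1)) (Y (t + 1)) (e (t + 1))) :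
    (n + 1 : ℝ) ≤ (5 + 8 / rateExponent p) * Y n ^ rateExponent p := by
  have hY : ∀ t ≤ n, 1 ≤ Y t := fun t ht => by
    induction t with
    | zero => exact hY0
    | succ t ih => exact (ih (by lia)).trans (hstep t ht).weight_le
  have hYn : ∀ t ≤ n, Y t ≤ Y n := fun t ht => by
    induction ht using Nat.decreasingInduction with
    | self => exact le_rfl
    | of_succ t ht ih => exact (hstep t ht).weight_le.trans ih
  have hlam : ∀ t ≤ n, 0 < lam t := fun t ht => by
    induction t with
    | zero => exact hlam0
    | succ t ih => exact (hstep t ht).guess_pos (ih (by lia))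
  have htelescope : ∀ t ≤ n, t + growthPotential p (lam t) (Y t) ≤
      growthPotential p (lam 0) (Y 0) + Y n ^ rateExponent p * (e 0 - e t) := fun t ht => by
    induction t with
    | zero => simp
    | succ t ih =>
      have hdrop := (hstep t ht).growthPotential_add_one_le hp (hlam t (by lia))
        (zero_lt_one.trans_le (hY t (by lia))) (hYn t (by lia))
      have hprev := ih (by lia)
      push_cast
      linarith
  have hlower := neg_mul_rpow_le_growthPotential (p := p) (lam := lam n) (hY n le_rfl)
  have hupper := growthPotential_le_three hp hlam0 hY0 hprod
  have hpow := Real.one_le_rpow (hY n le_rfl) (rateExponent_pos p).le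
  have henergy : Y n ^ rateExponent p * (e 0 - e n) ≤ Y n ^ rateExponent p :=
    mul_le_of_le_one_right (by linarith) (by linarith)
  linarith [htelescope n le_rfl]

end Growth

section ScaledIteration

variable {E : Type*} [NormedAddCommGroup E] [InnerProductSpace ℝ E] [CompleteSpace E]

variable {p t : ℕ} {M γ L μ : ℝ} {Z : Set E} {h : E → ℝ} {s s' : IterState E}
  {lam lam' a' gam : ℝ} {zbar u x : E}

namespace IsRegularIteration

theorem growthStep (hp : 1 ≤ p) (hL : 0 < L) (hμ : 0 ≤ μ) (hZ : Convex ℝ Z) {q : ℕ}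
    (hh : UniformlyConvex q μ Z h) (hLip : LipschitzDerivOn p L Z h)
    (hit : IsRegularIteration p (2 * L) L Z h s s' lam s.lam' a' gam zbar u) (hs : s.Valid Z t)
    (hx : x ∈ Z) {R G : ℝ} (hR : 0 < R) (hG : G = L * R ^ (p - 1)) :
    GrowthStep p (s.lam' / G) (2 * G * s.A) (8 * (p ! : ℝ) / (3 * R ^ 2) * s.energy h x)
      (s'.lam' / G) (2 * G * s'.A) (8 * (p ! : ℝ) / (3 * R ^ 2) * s'.energy h x) where
  weight_le := by
    have hG0 : 0 < G := hG ▸ by positivity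
    gcongr
    exact hit.A_le
  energy_le := by
    gcongr
    exact hit.energy_le hp hL.le hμ hZ hh hLip hs hx
  halving_or_doubling := by
    have hG0 : 0 < G := hG ▸ by positivity
    have ha' := hit.a'_pos
    rcases le_or_gt lam s.lam' with hle | hlt
    · have hA_eq : s'.A = s.A + a' := by
        rw [hit.A_eq, hit.gam_eq, dampingFactor, if_pos hle, one_mul]
      refine Or.inl ⟨by rw [hit.lam'_eq, if_pos hle]; ring, 2 * G * a', by positivity, ?_, ?_⟩
      · rw [hA_eq]
        ring
      · rw [hA_eq, hit.add_eq]
        field_simp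
    · refine Or.inr ⟨by rw [hit.lam'_eq, if_neg hlt.not_ge]; ring, ‖s'.zt - zbar‖ / R,
        by positivity, ?_, ?_⟩
      · rw [div_le_iff₀ hG0]
        calc s.lam' ≤ L * ‖s'.zt - zbar‖ ^ (p - 1) := hit.lam_eq ▸ hlt.le
          _ = (‖s'.zt - zbar‖ / R) ^ (p - 1) * G := by rw [hG, div_pow]; field_simp
      · have hloss := hit.energy_add_le_of_lt hp hL.le hμ hZ hh hLip hs hx hlt
        rw [← mul_sub]
        calc 2 * G * s.A * (s.lam' / G) * (‖s'.zt - zbar‖ / R) ^ 2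
            = 8 * (p ! : ℝ) / (3 * R ^ 2) *
                (3 / 4 * (s.A * (s.lam' / (p ! : ℝ)) * ‖s'.zt - zbar‖ ^ 2)) := by
              field_simp
              ring
          _ ≤ _ := by
            gcongr
            linarith

theorem a'_mul_lam'_eq (hit : IsRegularIteration p M γ Z h s s' lam lam' a' gam zbar u)
    (hA : s.A = 0) : a' * lam' = 1 / 2 := by
  have heq := hit.add_eq
  rw [hA, zero_add] at heq
  exact mul_left_cancel₀ hit.a'_pos.ne' (by linarith)

theorem A_mul_lam'_eq (hit : IsRegularIteration p M γ Z h s s' lam lam a' gam zbar u)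
    (hA : s.A = 0) : s'.A * s'.lam' = 1 / 4 := by
  rw [hit.A_eq, hit.lam'_eq, hit.gam_eq, dampingFactor, if_pos le_rfl, if_pos le_rfl, hA]
  linear_combination 1 / 2 * hit.a'_mul_lam'_eq hA

theorem norm_sub_le (hp : 1 ≤ p) (hL : 0 ≤ L) (hμ : 0 ≤ μ) (hZ : Convex ℝ Z) {q : ℕ}
    (hh : UniformlyConvex q μ Z h) (hLip : LipschitzDerivOn p L Z h)
    (hit : IsRegularIteration p (2 * L) L Z h s s' lam lam a' gam zbar u) (hs : s.Valid Z t)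
    (hA : s.A = 0) (hx : x ∈ Z) (hmin : IsMinOn h Z x) :
    ‖s'.zt - zbar‖ ≤ 2 * (p ! : ℝ) * ‖s.v - x‖ := by
  have hfac : (1 : ℝ) ≤ (p ! : ℝ) := mod_cast p.factorial_pos
  have henergy := hit.energy_add_le hp hL hμ hZ hh hLip hs hx
  have hnonneg := (hit.valid hZ hs).energy_nonneg hmin
  have hinit : s.energy h x = 1 / 2 * ‖s.v - x‖ ^ 2 := by rw [IterState.energy, hA]; ring
  have hloss : gam * (s.A + a') * (lam / (p ! : ℝ)) * ‖s'.zt - zbar‖ ^ 2 =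
      1 / 2 * ‖s'.zt - zbar‖ ^ 2 / (p ! : ℝ) := by
    rw [hit.gam_eq, dampingFactor, if_pos le_rfl, hA, ← hit.a'_mul_lam'_eq hA]
    ring
  refine (sq_le_sq₀ (by positivity) (by positivity)).1 ?_
  rw [hloss, hinit] at henergy
  have hle : 1 / 2 * ‖s'.zt - zbar‖ ^ 2 / (p ! : ℝ) ≤ 2 / 3 * ‖s.v - x‖ ^ 2 := by linarith
  rw [div_le_iff₀ (by positivity)] at hle
  calc ‖s'.zt - zbar‖ ^ 2 ≤ 4 * ((p ! : ℝ) * 1) * ‖s.v - x‖ ^ 2 := by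
        linarith [show 0 ≤ ‖s.v - x‖ ^ 2 * (p ! : ℝ) by positivity]
    _ ≤ 4 * ((p ! : ℝ) * (p ! : ℝ)) * ‖s.v - x‖ ^ 2 := by gcongr
    _ = (2 * (p ! : ℝ) * ‖s.v - x‖) ^ 2 := by ring

theorem two_mul_lam'_le (hp : 1 ≤ p) (hL : 0 ≤ L) (hμ : 0 ≤ μ) (hZ : Convex ℝ Z) {q : ℕ}
    (hh : UniformlyConvex q μ Z h) (hLip : LipschitzDerivOn p L Z h)
    (hit : IsRegularIteration p (2 * L) L Z h s s' lam lam a' gam zbar u) (hs : s.Valid Z t)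
    (hA : s.A = 0) (hx : x ∈ Z) (hmin : IsMinOn h Z x) :
    2 * s'.lam' ≤ L * (2 * (p ! : ℝ) * ‖s.v - x‖) ^ (p - 1) := by
  rw [hit.lam'_eq, if_pos le_rfl, mul_div_cancel₀ _ two_ne_zero, hit.lam_eq]
  gcongr
  exact hit.norm_sub_le hp hL hμ hZ hh hLip hs hA hx hmin

theorem one_le_mul_A (hp : 1 ≤ p) (hL : 0 ≤ L) (hμ : 0 ≤ μ) (hZ : Convex ℝ Z) {q : ℕ}
    (hh : UniformlyConvex q μ Z h) (hLip : LipschitzDerivOn p L Z h)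
    (hit : IsRegularIteration p (2 * L) L Z h s s' lam lam a' gam zbar u) (hs : s.Valid Z t)
    (hA : s.A = 0) (hx : x ∈ Z) (hmin : IsMinOn h Z x) :
    1 ≤ 2 * (L * (2 * (p ! : ℝ) * ‖s.v - x‖) ^ (p - 1)) * s'.A :=
  calc 1 = 2 * (2 * s'.lam') * s'.A := by linear_combination -4 * hit.A_mul_lam'_eq hA
    _ ≤ _ := mul_le_mul_of_nonneg_right
      (mul_le_mul_of_nonneg_left (hit.two_mul_lam'_le hp hL hμ hZ hh hLip hs hA hx hmin) two_pos.le)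
      (hit.A_pos hs).le

end IsRegularIteration

end ScaledIteration

section Epoch

variable {E : Type*} [NormedAddCommGroup E] [InnerProductSpace ℝ E] [CompleteSpace E]

variable {p q T : ℕ} {M γ L μ : ℝ} {Z : Set E} {h : E → ℝ} {z x : E} {st : ℕ → IterState E}

/-- `st 0, …, st T` are the states of an epoch of `T` iterations started at `z`. -/
structure IsEpochTrace (p : ℕ) (M γ : ℝ) (Z : Set E) (h : E → ℝ) (T : ℕ) (z : E)
    (st : ℕ → IterState E) : Prop where
  init : st 0 = IterState.init z
  iteration : ∀ t < T, IsIteration p M γ Z h t (st t) (st (t + 1))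

namespace IsEpochTrace

theorem valid (htr : IsEpochTrace p M γ Z h T z st) (hγ : 0 ≤ γ) (hZ : Convex ℝ Z) (hz : z ∈ Z)
    {t : ℕ} (ht : t ≤ T) : (st t).Valid Z t := by
  induction t with
  | zero => exact htr.init ▸ IterState.valid_init hz
  | succ t ih => exact (htr.iteration t ht).valid hγ hZ (ih (Nat.le_of_succ_le ht))

theorem length_queries_le (htr : IsEpochTrace p M γ Z h T z st) {t : ℕ} (ht : t ≤ T) :
    (st t).queries.length ≤ 4 * t := by
  induction t with
  | zero => simp [htr.init, IterState.init]
  | succ t ih => exact (htr.iteration t ht).length_queries_le.trans (by lia)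

theorem energy_le (htr : IsEpochTrace p (2 * L) L Z h T z st) (hp : 1 ≤ p) (hL : 0 ≤ L)
    (hμ : 0 ≤ μ) (hZ : Convex ℝ Z) (hh : UniformlyConvex q μ Z h) (hLip : LipschitzDerivOn p L Z h)
    (hz : z ∈ Z) (hx : x ∈ Z) {t : ℕ} (ht : t ≤ T) :
    (st t).energy h x ≤ 1 / 2 * ‖z - x‖ ^ 2 := by
  induction t with
  | zero => simp [htr.init, IterState.energy, IterState.init]
  | succ t ih =>
    have ht' := Nat.le_of_succ_le ht
    exact ((htr.iteration t ht).energy_le hp hL hμ hZ hh hLip (htr.valid hL hZ hz ht') hx).trans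
      (ih ht')

theorem exists_isRegularIteration_zero (htr : IsEpochTrace p M γ Z h T z st) (hT : 0 < T)
    (hp : 1 ≤ p) (hγ : 0 < γ) (hZ : Convex ℝ Z) (hμ : 0 ≤ μ) (hh : UniformlyConvex q μ Z h)
    (hLip : LipschitzDerivOn p L Z h) (hz : z ∈ Z) (hx : x ∈ Z) (hlt : h x < h (st 1).zt) :
    ∃ lam a' gam : ℝ, ∃ zbar u : E,
      IsRegularIteration p M γ Z h (IterState.init z) (st 1) lam lam a' gam zbar u := by
  have hit := htr.iteration 0 hT
  rw [htr.init, zero_add] at hit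
  rcases hit.halting_or_regular hγ.le (IterState.valid_init hz) one_ne_zero with
    ⟨-, u, hhalt⟩ | ⟨_, _, a', gam, zbar, u, hreg, rfl⟩
  · exact absurd (hhalt.apply_zt_le hp hγ hZ hμ hh hLip hz hx) hlt.not_ge
  · exact ⟨_, a', gam, zbar, u, hreg⟩

theorem lam'_pos (htr : IsEpochTrace p M γ Z h T z st) (hp : 1 ≤ p) (hγ : 0 < γ) (hZ : Convex ℝ Z)
    (hμ : 0 ≤ μ) (hh : UniformlyConvex q μ Z h) (hLip : LipschitzDerivOn p L Z h) (hz : z ∈ Z)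
    (hx : x ∈ Z) (hlt : h x < h (st 1).zt) {t : ℕ} (ht : t < T) : 0 < (st (t + 1)).lam' := by
  induction t with
  | zero =>
    obtain ⟨_, _, _, _, _, hreg⟩ :=
      htr.exists_isRegularIteration_zero ht hp hγ hZ hμ hh hLip hz hx hlt
    exact hreg.lam'_pos_succ
  | succ t ih =>
    obtain ⟨_, _, _, _, _, hreg⟩ := (htr.iteration (t + 1) ht).exists_isRegularIteration
      hγ.le (htr.valid hγ.le hZ hz ht.le) (ih (Nat.lt_of_succ_lt ht)).ne' t.succ_ne_zero
    exact hreg.lam'_pos_succ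

theorem growthStep (htr : IsEpochTrace p (2 * L) L Z h T z st) (hp : 1 ≤ p) (hL : 0 < L)
    (hμ : 0 ≤ μ) (hZ : Convex ℝ Z) (hh : UniformlyConvex q μ Z h) (hLip : LipschitzDerivOn p L Z h)
    (hz : z ∈ Z) (hx : x ∈ Z) (hlt : h x < h (st 1).zt) {R G : ℝ} (hR : 0 < R)
    (hG : G = L * R ^ (p - 1)) {t : ℕ} (ht : t + 1 < T) :
    GrowthStep p ((st (t + 1)).lam' / G) (2 * G * (st (t + 1)).A)
      (8 * (p ! : ℝ) / (3 * R ^ 2) * (st (t + 1)).energy h x)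
      ((st (t + 2)).lam' / G) (2 * G * (st (t + 2)).A)
      (8 * (p ! : ℝ) / (3 * R ^ 2) * (st (t + 2)).energy h x) := by
  have hs := htr.valid hL.le hZ hz ht.le
  have hlam' := htr.lam'_pos hp hL hZ hμ hh hLip hz hx hlt (Nat.lt_of_succ_lt ht)
  obtain ⟨_, _, _, _, _, hreg⟩ :=
    (htr.iteration _ ht).exists_isRegularIteration hL.le hs hlam'.ne' t.succ_ne_zero
  exact hreg.growthStep hp hL hμ hZ hh hLip hs hx hR hG

theorem natCast_le_mul_rpow (htr : IsEpochTrace p (2 * L) L Z h T z st) (hp : 1 ≤ p) (hL : 0 < L)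
    (hμ : 0 ≤ μ) (hZ : Convex ℝ Z) (hh : UniformlyConvex q μ Z h) (hLip : LipschitzDerivOn p L Z h)
    (hz : z ∈ Z) (hx : x ∈ Z) (hmin : IsMinOn h Z x) (hlt : ∀ t ≤ T, h x < h (st t).zt) :
    (T : ℝ) ≤ (5 + 8 / rateExponent p) *
      (2 * (L * (2 * (p ! : ℝ) * ‖z - x‖) ^ (p - 1)) * (st T).A) ^ rateExponent p := by
  have hb := rateExponent_pos p
  obtain _ | n := T
  · have hA := (htr.valid hL.le hZ hz le_rfl).A_nonneg
    rw [Nat.cast_zero]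
    positivity
  have hlt1 := hlt 1 (by lia)
  obtain ⟨_, _, _, _, _, hreg⟩ :=
    htr.exists_isRegularIteration_zero n.succ_pos hp hL hZ hμ hh hLip hz hx hlt1
  have hne : z ≠ x := by
    rintro rfl
    simpa [htr.init, IterState.init] using hlt 0 (Nat.zero_le _)
  have hdist : 0 < ‖z - x‖ := norm_sub_pos_iff.2 hne
  have hR : 0 < 2 * (p ! : ℝ) * ‖z - x‖ := by positivity
  set R := 2 * (p ! : ℝ) * ‖z - x‖ with hR_eq
  have hG : 0 < L * R ^ (p - 1) := by positivity
  have henergy : 8 * (p ! : ℝ) / (3 * R ^ 2) * (st 1).energy h x ≤ 1 :=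
    calc 8 * (p ! : ℝ) / (3 * R ^ 2) * (st 1).energy h x
        ≤ 8 * (p ! : ℝ) / (3 * R ^ 2) * (1 / 2 * ‖z - x‖ ^ 2) := by
          gcongr
          exact htr.energy_le hp hL.le hμ hZ hh hLip hz hx (by lia)
      _ = 1 / (3 * (p ! : ℝ)) := by rw [hR_eq]; field_simp; ring
      _ ≤ 1 := div_le_one_of_le₀ (by exact_mod_cast (by have := p.factorial_pos; lia : 1 ≤ 3 * p !))
        (by positivity)
  rw [Nat.cast_succ]
  refine succ_le_mul_rpow_of_growthStep hp (Y := fun t => 2 * (L * R ^ (p - 1)) * (st (t + 1)).A)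
    (lam := fun t => (st (t + 1)).lam' / (L * R ^ (p - 1)))
    (e := fun t => 8 * (p ! : ℝ) / (3 * R ^ 2) * (st (t + 1)).energy h x)
    (hreg.one_le_mul_A hp hL.le hμ hZ hh hLip (IterState.valid_init hz) rfl hx hmin)
    (div_pos hreg.lam'_pos_succ hG) ?_ henergy
    (mul_nonneg (by positivity) ((htr.valid hL.le hZ hz le_rfl).energy_nonneg hmin))
    fun t ht => htr.growthStep hp hL hμ hZ hh hLip hz hx hlt1 hR rfl (Nat.succ_lt_succ ht)
  have hprod := hreg.A_mul_lam'_eq rfl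
  field_simp
  linear_combination 4 * hprod

end IsEpochTrace

end Epoch

section HalvingTheGap

variable {E : Type*} [NormedAddCommGroup E] [InnerProductSpace ℝ E] [CompleteSpace E]

variable {p q T : ℕ} {M γ L μ : ℝ} {Z : Set E} {h : E → ℝ} {z zout x : E} {qs : List E}

theorem UniformlyConvex.mul_norm_pow_le (hh : UniformlyConvex q μ Z h) (hZ : Convex ℝ Z)
    (hd : DifferentiableAt ℝ h x) (hx : x ∈ Z) (hmin : IsMinOn h Z x) (hz : z ∈ Z) :
    μ / q * ‖z - x‖ ^ q ≤ h z - h x := by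
  have hfirst_order : 0 ≤ ⟪∇ h x, z - x⟫ :=
    IsLocalMinOn.hasFDerivWithinAt_nonneg hmin.localize
      hd.hasGradientAt.hasFDerivAt.hasFDerivWithinAt
      (sub_mem_posTangentConeAt_of_segment_subset (hZ.segment_subset hx hz))
  linarith [hh z hz x hx]

/-- The factor `c` in the number `⌈c (L / μ) ^ (2 / (3 p + 1))⌉` of iterations of an epoch. -/
noncomputable def epochConstant (p : ℕ) : ℝ :=
  (5 + 8 / rateExponent p) *
    (2 * (p + 1) * (2 * (p ! : ℝ)) ^ (p - 1)) ^ rateExponent p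

theorem epochConstant_pos (p : ℕ) : 0 < epochConstant p := by
  have := rateExponent_pos p
  unfold epochConstant
  positivity

theorem div_le_of_epochConstant_mul_le {D A n : ℝ} (hL : 0 < L) (hμ : 0 < μ) (hD : 0 ≤ D)
    (hA : 0 ≤ A) (hlower : epochConstant p * (L / μ) ^ rateExponent p ≤ n)
    (hupper : n ≤ (5 + 8 / rateExponent p) *
      (2 * (L * (2 * (p ! : ℝ) * D) ^ (p - 1)) * A) ^ rateExponent p) :
    (p + 1) / μ ≤ D ^ (p - 1) * A := by
  have hb := rateExponent_pos p
  set F := (2 * (p ! : ℝ)) ^ (p - 1) with hF_eq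
  have hpow : (2 * (p + 1) * F * (L / μ)) ^ rateExponent p ≤
      (2 * (L * (2 * (p ! : ℝ) * D) ^ (p - 1)) * A) ^ rateExponent p := by
    rw [Real.mul_rpow (by positivity) (by positivity)]
    refine le_of_mul_le_mul_left ?_ (by positivity : 0 < 5 + 8 / rateExponent p)
    rw [← mul_assoc]
    exact hlower.trans hupper
  have hbase := (Real.rpow_le_rpow_iff (by positivity) (by positivity) hb).1 hpow
  rw [mul_pow, ← hF_eq] at hbase
  refine le_of_mul_le_mul_left ?_ (by positivity : 0 < 2 * F * L)
  calc 2 * F * L * ((p + 1) / μ) = 2 * (p + 1) * F * (L / μ) := by ring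
    _ ≤ 2 * (L * (F * D ^ (p - 1))) * A := hbase
    _ = 2 * F * L * (D ^ (p - 1) * A) := by ring

theorem IsEpoch.exists_isEpochTrace (hep : IsEpoch p M γ Z h T z zout qs) :
    ∃ st, IsEpochTrace p M γ Z h T z st ∧ ∀ t ≤ T, h zout ≤ h (st t).z ∧ h zout ≤ h (st t).zt := by
  obtain ⟨st, h0, hit, ⟨i, -, j, -, hmini, hminj, hout⟩, -⟩ := hep
  refine ⟨st, ⟨h0, hit⟩, fun t ht => ?_⟩
  rw [hout]
  split_ifs with hlt
  exacts [⟨hmini t ht, hlt.le.trans (hminj t ht)⟩, ⟨(not_lt.1 hlt).trans (hmini t ht), hminj t ht⟩]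

theorem IsEpoch.mem (hep : IsEpoch p M γ Z h T z zout qs) (hγ : 0 ≤ γ) (hZ : Convex ℝ Z)
    (hz : z ∈ Z) : zout ∈ Z := by
  obtain ⟨st, h0, hit, ⟨i, hi, j, hj, -, -, rfl⟩, -⟩ := hep
  have htr : IsEpochTrace p M γ Z h T z st := ⟨h0, hit⟩
  split_ifs
  exacts [(htr.valid hγ hZ hz hi).z_mem, (htr.valid hγ hZ hz hj).zt_mem]

theorem IsEpoch.length_queries_le (hep : IsEpoch p M γ Z h T z zout qs) :
    qs.length ≤ 4 * T + 2 := by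
  obtain ⟨st, h0, hit, -, rfl⟩ := hep
  simpa using IsEpochTrace.length_queries_le ⟨h0, hit⟩ le_rfl

theorem IsEpoch.sub_le_half (hep : IsEpoch p (2 * L) L Z h T z zout qs) (hp : 1 ≤ p) (hL : 0 < L)
    (hμ : 0 < μ) (hZ : Convex ℝ Z) (hh : UniformlyConvex (p + 1) μ Z h)
    (hLip : LipschitzDerivOn p L Z h) (hx : x ∈ Z) (hmin : IsMinOn h Z x)
    (hT : epochConstant p * (L / μ) ^ rateExponent p ≤ T) (hz : z ∈ Z) :
    h zout - h x ≤ 1 / 2 * (h z - h x) := by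
  have hgap : 0 ≤ h z - h x := sub_nonneg.2 (hmin hz)
  rcases le_or_gt (h zout) (h x) with hle | hlt
  · linarith
  obtain ⟨st, htr, hbest⟩ := hep.exists_isEpochTrace
  have hA := (htr.valid hL.le hZ hz le_rfl).A_nonneg
  set A := (st T).A
  set D := ‖z - x‖
  have hweight : (p + 1) / μ ≤ D ^ (p - 1) * A :=
    div_le_of_epochConstant_mul_le hL hμ (norm_nonneg _) hA hT
      (htr.natCast_le_mul_rpow hp hL hμ.le hZ hh hLip hz hx hmin
        fun t ht => hlt.trans_le (hbest t ht).2)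
  have hdist : μ / (p + 1) * D ^ (p + 1) ≤ h z - h x := by
    have hd := (hLip.1 x hx).differentiableAt (by exact_mod_cast (by lia : p ≠ 0))
    exact_mod_cast hh.mul_norm_pow_le hZ hd hx hmin hz
  have henergy : A * (h zout - h x) ≤ 1 / 2 * D ^ 2 :=
    calc A * (h zout - h x) ≤ A * (h (st T).z - h x) := by gcongr; exact (hbest T le_rfl).1
      _ ≤ (st T).energy h x := (st T).mul_sub_le_energy x
      _ ≤ 1 / 2 * D ^ 2 := htr.energy_le hp hL.le hμ.le hZ hh hLip hz hx le_rfl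
  have hsub : 0 ≤ h zout - h x := (sub_pos.2 hlt).le
  calc h zout - h x = μ / (p + 1) * ((p + 1) / μ * (h zout - h x)) := by field_simp
    _ ≤ μ / (p + 1) * (D ^ (p - 1) * A * (h zout - h x)) := by gcongr
    _ = μ / (p + 1) * D ^ (p - 1) * (A * (h zout - h x)) := by ring
    _ ≤ μ / (p + 1) * D ^ (p - 1) * (1 / 2 * D ^ 2) := by gcongr
    _ = 1 / 2 * (μ / (p + 1) * D ^ (p + 1)) := by
      rw [show p + 1 = p - 1 + 2 by lia, pow_add]; ring
    _ ≤ 1 / 2 * (h z - h x) := by gcongr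

end HalvingTheGap

section Restart

variable {E : Type*} [NormedAddCommGroup E] [InnerProductSpace ℝ E] [CompleteSpace E]

variable {p T S N : ℕ} {M γ L μ : ℝ} {Z : Set E} {h : E → ℝ} {z z0 zout x : E}

theorem exists_isEpochTrace [ProperSpace E] (hp : 1 ≤ p) (hM : 0 < M) (hγ : 0 ≤ γ)
    (hZc : IsClosed Z) (hZ : Convex ℝ Z) (hh : ∀ z ∈ Z, ContDiffAt ℝ p h z) (T : ℕ) (hz : z ∈ Z) :
    ∃ st, IsEpochTrace p M γ Z h T z st := by
  have : Nonempty (IterState E) := ⟨IterState.init z⟩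
  choose! next hnext using fun (t : ℕ) (s : IterState E) (hs : s.Valid Z t) =>
    exists_isIteration hp hM hγ hZc hZ hh hs
  let st : ℕ → IterState E := fun t => Nat.rec (IterState.init z) next t
  have hvalid : ∀ t, (st t).Valid Z t := by
    intro t
    induction t with
    | zero => exact IterState.valid_init hz
    | succ t ih => exact (hnext t _ ih).valid hγ hZ ih
  exact ⟨st, rfl, fun t _ => hnext t _ (hvalid t)⟩

theorem exists_isEpoch [ProperSpace E] (hp : 1 ≤ p) (hM : 0 < M) (hγ : 0 ≤ γ)
    (hZc : IsClosed Z) (hZ : Convex ℝ Z) (hh : ∀ z ∈ Z, ContDiffAt ℝ p h z) (T : ℕ) (hz : z ∈ Z) :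
    ∃ zout qs, IsEpoch p M γ Z h T z zout qs := by
  obtain ⟨st, htr⟩ := exists_isEpochTrace hp hM hγ hZc hZ hh T hz
  have exists_argmin : ∀ f : ℕ → ℝ, ∃ i ≤ T, ∀ t ≤ T, f i ≤ f t := fun f => by
    simpa [Nat.lt_succ_iff] using Finset.exists_min_image (Finset.range (T + 1)) f ⟨0, by simp⟩
  obtain ⟨i, hi, hmini⟩ := exists_argmin fun t => h (st t).z
  obtain ⟨j, hj, hminj⟩ := exists_argmin fun t => h (st t).zt
  exact ⟨_, _, st, htr.init, htr.iteration, ⟨i, hi, j, hj, hmini, hminj, rfl⟩, rfl⟩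

theorem exists_isRestartRun [ProperSpace E] (hp : 1 ≤ p) (hM : 0 < M) (hγ : 0 ≤ γ)
    (hZc : IsClosed Z) (hZ : Convex ℝ Z) (hh : ∀ z ∈ Z, ContDiffAt ℝ p h z) (T S : ℕ)
    (hz0 : z0 ∈ Z) : ∃ zout N, IsRestartRun p M γ Z h T S z0 zout N := by
  choose! next qs hnext using fun (z : E) (hz : z ∈ Z) => exists_isEpoch hp hM hγ hZc hZ hh T hz
  have hsucc (s : ℕ) : next^[s + 1] z0 = next (next^[s] z0) := Function.iterate_succ_apply' ..
  have hmem (s : ℕ) : next^[s] z0 ∈ Z := by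
    induction s with
    | zero => exact hz0
    | succ s ih => exact hsucc s ▸ (hnext _ ih).mem hγ hZ ih
  exact ⟨_, _, fun s => next^[s] z0, fun s => qs (next^[s] z0), rfl,
    fun s _ => by simpa only [hsucc] using hnext _ (hmem s), rfl, rfl⟩

namespace IsRestartRun

theorem eq_of_zero (hrun : IsRestartRun p M γ Z h T 0 z0 zout N) : zout = z0 := by
  obtain ⟨zs, _, h0, -, rfl, -⟩ := hrun
  exact h0

theorem exists_isEpoch (hrun : IsRestartRun p M γ Z h T (S + 1) z0 zout N) :
    ∃ z n qs, IsRestartRun p M γ Z h T S z0 z n ∧ IsEpoch p M γ Z h T z zout qs := by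
  obtain ⟨zs, qs, h0, hep, rfl, -⟩ := hrun
  exact ⟨zs S, _, qs S, ⟨zs, qs, h0, fun s hs => hep s (hs.trans S.lt_succ_self), rfl, rfl⟩,
    hep S S.lt_succ_self⟩

theorem calls_le (hrun : IsRestartRun p M γ Z h T S z0 zout N) : N ≤ S * (4 * T + 2) := by
  obtain ⟨zs, qs, -, hep, -, rfl⟩ := hrun
  simpa using Finset.sum_le_card_nsmul (Finset.range S) (fun s => (qs s).length) (4 * T + 2)
    fun s hs => (hep s (Finset.mem_range.1 hs)).length_queries_le

theorem mem (hrun : IsRestartRun p M γ Z h T S z0 zout N) (hγ : 0 ≤ γ) (hZ : Convex ℝ Z)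
    (hz0 : z0 ∈ Z) : zout ∈ Z := by
  induction S generalizing zout N with
  | zero => exact hrun.eq_of_zero ▸ hz0
  | succ S ih =>
    obtain ⟨_, _, _, hrun', hep⟩ := hrun.exists_isEpoch
    exact hep.mem hγ hZ (ih hrun')

theorem sub_le (hrun : IsRestartRun p (2 * L) L Z h T S z0 zout N) (hp : 1 ≤ p) (hL : 0 < L)
    (hμ : 0 < μ) (hZ : Convex ℝ Z) (hh : UniformlyConvex (p + 1) μ Z h)
    (hLip : LipschitzDerivOn p L Z h) (hx : x ∈ Z) (hmin : IsMinOn h Z x)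
    (hT : epochConstant p * (L / μ) ^ rateExponent p ≤ T) (hz0 : z0 ∈ Z) :
    h zout - h x ≤ (1 / 2) ^ S * (h z0 - h x) := by
  induction S generalizing zout N with
  | zero => rw [hrun.eq_of_zero, pow_zero, one_mul]
  | succ S ih =>
    obtain ⟨z, _, _, hrun', hep⟩ := hrun.exists_isEpoch
    calc h zout - h x ≤ 1 / 2 * (h z - h x) :=
          hep.sub_le_half hp hL hμ hZ hh hLip hx hmin hT (hrun'.mem hL.le hZ hz0)
      _ ≤ 1 / 2 * ((1 / 2) ^ S * (h z0 - h x)) := by gcongr; exact ih hrun'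
      _ = (1 / 2) ^ (S + 1) * (h z0 - h x) := by ring

end IsRestartRun

end Restart

section Complexity

theorem half_pow_ceil_logb_mul_le {Δ ε : ℝ} (hΔ : 0 ≤ Δ) (hε : 0 < ε) :
    (1 / 2 : ℝ) ^ ⌈Real.logb 2 (Δ / ε)⌉₊ * Δ ≤ ε := by
  rcases hΔ.eq_or_lt with rfl | hΔ
  · simpa using hε.le
  have hpow := (Real.logb_le_iff_le_rpow one_lt_two (div_pos hΔ hε)).1 (Nat.le_ceil _)
  rw [Real.rpow_natCast, div_le_iff₀ hε] at hpow
  rwa [one_div, inv_pow, inv_mul_le_iff₀ (by positivity)]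

theorem logb_two_le_two_mul_max (x : ℝ) : Real.logb 2 x ≤ 2 * max 1 (Real.log x) := by
  have hlog : (1 / 2 : ℝ) < Real.log 2 := by linarith [Real.log_two_gt_d9]
  rw [Real.logb, div_le_iff₀ (by linarith)]
  calc Real.log x ≤ max 1 (Real.log x) := le_max_right _ _
    _ = 2 * max 1 (Real.log x) * (1 / 2) := by ring
    _ ≤ 2 * max 1 (Real.log x) * Real.log 2 := by gcongr

theorem ceil_le_add_one_mul_max {c x y : ℝ} (hc : 0 ≤ c) (hx : x ≤ c * max 1 y) :
    (⌈x⌉₊ : ℝ) ≤ (c + 1) * max 1 y := by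
  have hone : (1 : ℝ) ≤ max 1 y := le_max_left _ _
  calc (⌈x⌉₊ : ℝ) ≤ ⌈c * max 1 y⌉₊ := by gcongr
    _ ≤ c * max 1 y + 1 := (Nat.ceil_lt_add_one (by positivity)).le
    _ ≤ (c + 1) * max 1 y := by linarith

variable {E : Type*} [NormedAddCommGroup E] [InnerProductSpace ℝ E] [CompleteSpace E]

theorem IsRestartRun.calls_le_mul_max {p T S N : ℕ} {M γ c x r : ℝ} {Z : Set E} {h : E → ℝ}
    {z0 zout : E} (hrun : IsRestartRun p M γ Z h T S z0 zout N) (hc : 0 < c) (hx : 0 < x)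
    (hT : T = ⌈c * x⌉₊) (hS : S = ⌈Real.logb 2 r⌉₊) :
    (N : ℝ) ≤ 18 * (c + 1) * max 1 x * max 1 (Real.log r) := by
  have hT_one : (1 : ℝ) ≤ T := mod_cast hT ▸ Nat.ceil_pos.2 (by positivity)
  have hT_le : (T : ℝ) ≤ (c + 1) * max 1 x :=
    hT ▸ ceil_le_add_one_mul_max hc.le (by gcongr; exact le_max_right _ _)
  have hS_le : (S : ℝ) ≤ (2 + 1) * max 1 (Real.log r) :=
    hS ▸ ceil_le_add_one_mul_max zero_le_two (logb_two_le_two_mul_max r)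
  calc (N : ℝ) ≤ S * (4 * T + 2) := mod_cast hrun.calls_le
    _ ≤ S * (6 * T) := by gcongr; linarith
    _ ≤ (2 + 1) * max 1 (Real.log r) * (6 * ((c + 1) * max 1 x)) := by gcongr
    _ = 18 * (c + 1) * max 1 x * max 1 (Real.log r) := by ring

end Complexity

theorem mainTheorem5_general.{u} (p : ℕ) (hp : 1 ≤ p) :
    ∃ c C : ℝ, 0 < c ∧ 0 < C ∧
      ∀ (E : Type u) [NormedAddCommGroup E] [InnerProductSpace ℝ E] [CompleteSpace E]
        (Z : Set E) (h : E → ℝ) (μ L ε : ℝ) (z0 zstar : E) (T S : ℕ),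
        Convex ℝ Z → 0 < μ → 0 < L → 0 < ε →
        UniformlyConvex (p + 1) μ Z h →
        LipschitzDerivOn p L Z h →
        z0 ∈ Z → zstar ∈ Z → IsMinOn h Z zstar →
        T = ⌈c * (L / μ) ^ ((2 : ℝ) / (3 * p + 1))⌉₊ →
        S = ⌈Real.logb 2 ((h z0 - h zstar) / ε)⌉₊ →
        (ProperSpace E → IsClosed Z → ∃ zout N, IsRestartRun p (2 * L) L Z h T S z0 zout N) ∧
        ∀ zout N, IsRestartRun p (2 * L) L Z h T S z0 zout N →
          zout ∈ Z ∧ h zout - h zstar ≤ ε ∧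
          (N : ℝ) ≤ C * max 1 ((L / μ) ^ ((2 : ℝ) / (3 * p + 1))) *
            max 1 (Real.log ((h z0 - h zstar) / ε)) := by
  have hc := epochConstant_pos p
  refine ⟨epochConstant p, 18 * (epochConstant p + 1), hc, by positivity, ?_⟩
  intro E _ _ _ Z h μ L ε z0 zstar T S hZ hμ hL hε hh hLip hz0 hstar hmin hT hS
  refine ⟨fun _ hZc => exists_isRestartRun hp (by positivity) hL.le hZc hZ hLip.1 T S hz0,
    fun zout N hrun => ⟨hrun.mem hL.le hZ hz0, ?_, ?_⟩⟩
  · calc h zout - h zstar ≤ (1 / 2) ^ S * (h z0 - h zstar) :=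
          hrun.sub_le hp hL hμ hZ hh hLip hstar hmin (hT ▸ Nat.le_ceil _) hz0
      _ ≤ ε := hS ▸ half_pow_ceil_logb_mul_le (sub_nonneg.2 (hmin hz0)) hε
  · exact hrun.calls_le_mul_max hc (Real.rpow_pos_of_pos (div_pos hL hμ) _) hT hS

theorem mainTheorem5 (p : ℕ) (hp : 1 ≤ p) :
    ∃ c C : ℝ, 0 < c ∧ 0 < C ∧
      ∀ (d : ℕ) (Z : Set (EuclideanSpace ℝ (Fin d))) (h : EuclideanSpace ℝ (Fin d) → ℝ)
        (μ L ε : ℝ) (z0 zstar : EuclideanSpace ℝ (Fin d)) (T S : ℕ),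
        IsClosed Z → Convex ℝ Z →
        0 < μ → 0 < L → 0 < ε →
        UniformlyConvex (p + 1) μ Z h →
        LipschitzDerivOn p L Z h →
        z0 ∈ Z → zstar ∈ Z → IsMinOn h Z zstar →
        T = ⌈c * (L / μ) ^ ((2 : ℝ) / (3 * p + 1))⌉₊ →
        S = ⌈Real.logb 2 ((h z0 - h zstar) / ε)⌉₊ →
        (∃ zout N, IsRestartRun p (2 * L) L Z h T S z0 zout N) ∧
        ∀ zout N, IsRestartRun p (2 * L) L Z h T S z0 zout N →
          zout ∈ Z ∧ h zout - h zstar ≤ ε ∧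
          (N : ℝ) ≤ C * max 1 ((L / μ) ^ ((2 : ℝ) / (3 * p + 1))) *
            max 1 (Real.log ((h z0 - h zstar) / ε)) := by
  obtain ⟨c, C, hc, hC, hmain⟩ := mainTheorem5_general p hp
  exact ⟨c, C, hc, hC, fun d Z h μ L ε z0 zstar T S hZc hZ hμ hL hε hh hLip hz0 hstar hmin hT hS =>
    (hmain _ Z h μ L ε z0 zstar T S hZ hμ hL hε hh hLip hz0 hstar hmin hT hS).imp_left
      fun hrun => hrun inferInstance hZc⟩
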